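/- Let $n$ be a natural number and $0<x_1<\dots<x_n<1$. An $n$-component virtual string link diagram $S$ is a smooth immersion of $n$ oriented intervals $[0,1]_i$ into $[0,1]\times[0,1]$, the $i$th one running from $(x_i,0)$ to $(x_i,1)$ (through the interior of the square, transverse to its boundary), whose only singularities are finitely many transverse double points, each of them declared to be a classical crossing (with over/under information) or a virtual crossing. Two diagrams are welded isotopic if they are related by a finite sequence of planar isotopies fixing the boundary of the square and of welded Reidemeister moves, i.e. the classical Reidemeister moves R1--R3 (with all orientations), the virtual moves V1--V4 and the over-crossings commute move OC. An $n$-component welded string link is an equivalence class under welded isotopy. Identifying points on the boundary of the square that have the same first coordinate turns $S$ into a virtual link diagram $D_S$, with base points $p_i$ the images of $(x_i,0)\sim(x_i,1)$. The classical under-crossings and the base points divide $D_S$ into arcs; let $a_{i1},a_{i2},\dots,a_{i\,m_i+1}$ be the arcs of the $i$th component in the order in which they are met from $p_i$ on. Let $u_{ij}$ be the over-passing arc and $\varepsilon_{ij}$ the sign of the crossing between $a_{ij}$ and $a_{i\,j+1}$, and put $v_{ij}=u_{i1}^{\varepsilon_{i1}}\cdots u_{ij}^{\varepsilon_{ij}}$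 for $1\le j\le m_i$, with $v_{i0}=1$. Let $A$ be the free group on $\alpha_1,\dots,\alpha_n$ and let $\overline A$ be the free group on the arcs. Define homomorphisms $\eta_q:\overline A\to A$ for $q\ge1$ by $\eta_1(a_{ij})=\alpha_i$, $\eta_{q+1}(a_{i1})=\alpha_i$ and $\eta_{q+1}(a_{ij})=\eta_q(v_{i\,j-1})^{-1}\alpha_i\,\eta_q(v_{i\,j-1})$ for $j\ge2$. Let $w_i$ be the sum of the signs of the classical self-crossings of the $i$th component, and $l_i=a_{i1}^{-w_i}v_{im_i}$. Let $E:A\to\mathbb Z\langle\langle X_1,\dots,X_n\rangle\rangle^{\times}$ be the Magnus expansion, $E(\alpha_i)=1+X_i$. For a sequence $I=j_1\dots j_s i$ of indices in $\{1,\dots,n\}$ and $q>s$, let $\mu_S^{(q)}(I)\in\mathbb Z$ be the coefficient of $X_{j_1}\cdots X_{j_s}$ in $E(\eta_q(l_i))$, and put $\mu_S(I)=\mu_S^{(s+1)}(I)$. Then: 1. $\mu_S^{(q)}(I)=\mu_S(I)$ for every $q>s$, so that the Milnor number $\mu_S(I)\in\mathbb Z$ does not depend on the choice of $q$. 2. If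 $S$ and $S'$ are welded isotopic (i.e. are diagrams of the same welded string link), then $\mu_S(I)=\mu_{S'}(I)$ for every sequence $I$ of indices in $\{1,\dots,n\}$. -/

import Mathlib

open Set
open scoped ContDiff

noncomputable section

namespace WeldedMilnor

/-! ### Non-commutative formal power series and the Magnus expansion -/

/-- The ring `ℤ⟨⟨X₁, …, Xₙ⟩⟩` of formal power series in non-commuting variables: the value of a
series at the word `[j₁, …, jₛ]` is its coefficient of `X_{j₁} ⋯ X_{jₛ}`. -/
def NCSeries (n : ℕ) : Type := List (Fin n) → ℤ

namespace NCSeries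

variable {n : ℕ}

@[ext] theorem ext {f g : NCSeries n} (h : ∀ w, f w = g w) : f = g := funext h

instance : AddCommGroup (NCSeries n) := inferInstanceAs (AddCommGroup (List (Fin n) → ℤ))

/-- The Cauchy product: sum over all ways of cutting a word in two. -/
instance : Mul (NCSeries n) :=
  ⟨fun f g w => ∑ k ∈ Finset.range (w.length + 1), f (w.take k) * g (w.drop k)⟩

instance : One (NCSeries n) := ⟨fun w => if w = [] then 1 else 0⟩

theorem add_apply (f g : NCSeries n) (w : List (Fin n)) : (f + g) w = f w + g w := rfl

theorem zero_apply (w : List (Fin n)) : (0 : NCSeries n) w = 0 := rfl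

theorem mul_apply (f g : NCSeries n) (w : List (Fin n)) :
    (f * g) w = ∑ k ∈ Finset.range (w.length + 1), f (w.take k) * g (w.drop k) := rfl

theorem one_apply (w : List (Fin n)) : (1 : NCSeries n) w = if w = [] then 1 else 0 := rfl

theorem mul_nil (f g : NCSeries n) : (f * g) [] = f [] * g [] := by
  simp [mul_apply]

/-- The coefficients of `f` at the words that start with `a`. -/
def tail (a : Fin n) (f : NCSeries n) : NCSeries n := fun w => f (a :: w)

theorem mul_cons (f g : NCSeries n) (a : Fin n) (w : List (Fin n)) :
    (f * g) (a :: w) = f [] * g (a :: w) + (tail a f * g) w := by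
  rw [mul_apply, mul_apply, List.length_cons, Finset.sum_range_succ', add_comm]
  rfl

theorem tail_mul (f g : NCSeries n) (a : Fin n) (w : List (Fin n)) :
    tail a (f * g) w = f [] * tail a g w + (tail a f * g) w := mul_cons f g a w

theorem series_left_distrib (f g h : NCSeries n) : f * (g + h) = f * g + f * h := by
  ext w
  simp only [add_apply, mul_apply, mul_add, Finset.sum_add_distrib]

theorem series_right_distrib (f g h : NCSeries n) : (f + g) * h = f * h + g * h := by
  ext w
  simp only [add_apply, mul_apply, add_mul, Finset.sum_add_distrib]

theorem series_mul_assoc (f g h : NCSeries n) : f * g * h = f * (g * h) := by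
  ext w
  induction w generalizing f g h with
  | nil => simp only [mul_nil, mul_assoc]
  | cons a w ih =>
    have key : (tail a (f * g) * h) w = f [] * (tail a g * h) w + (tail a f * g * h) w := by
      obtain ⟨s, hs⟩ : ∃ s : NCSeries n, ∀ v, s v = f [] * tail a g v := ⟨_, fun _ => rfl⟩
      have e : tail a (f * g) = s + tail a f * g := by
        ext v
        rw [add_apply, hs]
        exact tail_mul f g a v
      rw [e, series_right_distrib, add_apply]
      congr 1
      simp only [mul_apply, hs, Finset.mul_sum, mul_assoc]
    rw [mul_cons, mul_cons, mul_nil, mul_cons, key, ih]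
    ring

theorem series_one_mul (f : NCSeries n) : 1 * f = f := by
  ext w
  rw [mul_apply, Finset.sum_eq_single 0]
  · simp [one_apply]
  · intro k hk hk0
    have : w.take k ≠ [] := by
      intro h
      rcases List.take_eq_nil_iff.1 h with h | h
      · exact hk0 h
      · subst h
        simp at hk
        exact hk0 hk
    simp [one_apply, this]
  · simp

theorem series_mul_one (f : NCSeries n) : f * 1 = f := by
  ext w
  rw [mul_apply, Finset.sum_eq_single w.length]
  · simp [one_apply]
  · intro k hk hk0
    have : w.drop k ≠ [] := by
      intro h
      rw [List.drop_eq_nil_iff] at h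
      simp only [Finset.mem_range] at hk
      omega
    simp [one_apply, this]
  · simp

instance : Ring (NCSeries n) :=
  { (inferInstance : AddCommGroup (NCSeries n)) with
    mul := (· * ·)
    one := 1
    left_distrib := series_left_distrib
    right_distrib := series_right_distrib
    mul_assoc := series_mul_assoc
    one_mul := series_one_mul
    mul_one := series_mul_one
    zero_mul := fun f => by
      ext w
      simp [mul_apply, zero_apply]
    mul_zero := fun f => by
      ext w
      simp [mul_apply, zero_apply] }

/-- The series `1 + X_i`. -/
def oneAddX (i : Fin n) : NCSeries n := fun w => if w = [] ∨ w = [i] then 1 else 0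

/-- The series `1 - X_i + X_i² - X_i³ + ⋯`. -/
def altGeom (i : Fin n) : NCSeries n := fun w => if ∀ j ∈ w, j = i then (-1) ^ w.length else 0

theorem tail_oneAddX (i a : Fin n) : tail a (oneAddX i) = if a = i then 1 else 0 := by
  ext w
  by_cases h : a = i <;> simp [tail, oneAddX, one_apply, zero_apply, h]

theorem tail_altGeom (i a : Fin n) : tail a (altGeom i) = if a = i then -altGeom i else 0 := by
  ext w
  by_cases h : a = i
  · have e : (-altGeom i) w = -(altGeom i w) := rfl
    simp only [h, if_true, e]
    by_cases h' : ∀ j ∈ w, j = i <;> simp [tail, altGeom, pow_succ, apply_ite Neg.neg]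
  · simp [tail, altGeom, zero_apply, h]

theorem oneAddX_mul_altGeom (i : Fin n) : oneAddX i * altGeom i = 1 := by
  ext w
  cases w with
  | nil => simp [mul_nil, oneAddX, altGeom, one_apply]
  | cons a w =>
    have e : (-altGeom i) w = -(altGeom i w) := rfl
    have t : altGeom i (a :: w) = tail a (altGeom i) w := rfl
    rw [mul_cons, tail_oneAddX, t, tail_altGeom]
    by_cases h : a = i
    · simp [h, e, oneAddX, one_apply]
    · simp [h, zero_apply, one_apply]

theorem altGeom_mul_oneAddX (i : Fin n) : altGeom i * oneAddX i = 1 := by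
  ext w
  induction w with
  | nil => simp [mul_nil, oneAddX, altGeom, one_apply]
  | cons a w ih =>
    have t : oneAddX i (a :: w) = tail a (oneAddX i) w := rfl
    rw [mul_cons, tail_altGeom, t, tail_oneAddX]
    by_cases h : a = i
    · have e : (-altGeom i * oneAddX i) w = -((altGeom i * oneAddX i) w) := by
        rw [neg_mul]
        rfl
      simp only [h, if_true, e, ih]
      simp [altGeom, one_apply]
    · simp [h, zero_apply, one_apply]

/-- `1 + X_i` as a unit of the ring of power series. -/
def unitOneAddX (i : Fin n) : (NCSeries n)ˣ :=
  ⟨oneAddX i, altGeom i, oneAddX_mul_altGeom i, altGeom_mul_oneAddX i⟩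

end NCSeries

/-- The Magnus expansion `E`, the homomorphism with `E(α_i) = 1 + X_i`. -/
def magnus {n : ℕ} : FreeGroup (Fin n) →* (NCSeries n)ˣ := FreeGroup.lift NCSeries.unitOneAddX

/-! ### Virtual link diagrams with a base point system -/

/-- An `n`-component virtual link diagram with a base point system, drawn on a surface `X`.
The `n` oriented circles are copies of `ℝ/ℤ`; a pair `(i, c)` is the point `c` of the `i`-th
circle. There are finitely many double points and no triple points. `upper p = some q` says that
a classical crossing is passed at `p` along its lower and at `q` along its upper strand; `sign p` is
then the sign of this crossing. The other double points are the virtual crossings. -/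
structure BasedLinkDiagram (n : ℕ) (X : Type) [TopologicalSpace X] where
  curve : Fin n → UnitAddCircle → X
  continuous_curve : ∀ i, Continuous (curve i)
  finite_double : {z : (Fin n × UnitAddCircle) × (Fin n × UnitAddCircle) |
    z.1 ≠ z.2 ∧ curve z.1.1 z.1.2 = curve z.2.1 z.2.2}.Finite
  no_triple : ∀ p q r : Fin n × UnitAddCircle, p ≠ q → p ≠ r →
    curve p.1 p.2 = curve q.1 q.2 → curve p.1 p.2 = curve r.1 r.2 → q = r
  upper : Fin n × UnitAddCircle → Option (Fin n × UnitAddCircle)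
  upper_double : ∀ p q, upper p = some q → p ≠ q ∧ curve p.1 p.2 = curve q.1 q.2
  upper_upper : ∀ p q, upper p = some q → upper q = none
  sign : Fin n × UnitAddCircle → ℤˣ
  base : Fin n → UnitAddCircle
  base_not_double : ∀ i, ∀ p, p ≠ (i, base i) → curve p.1 p.2 ≠ curve i (base i)

namespace BasedLinkDiagram

variable {n : ℕ} {X : Type} [TopologicalSpace X] (D : BasedLinkDiagram n X)

/-- The time in `[0, 1)` at which the point `p` is reached when its circle is travelled along,
starting at the base point. -/
def time (p : Fin n × UnitAddCircle) : ℝ :=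
  (AddCircle.equivIco (1 : ℝ) 0 (p.2 - D.base p.1) : ℝ)

/-- The classical under-crossings, as points of the circles. -/
def underPoints : Set (Fin n × UnitAddCircle) := {p | D.upper p ≠ none}

theorem finite_underPoints : D.underPoints.Finite := by
  refine (D.finite_double.image Prod.fst).subset ?_
  intro p hp
  obtain ⟨q, hq⟩ := Option.ne_none_iff_exists'.1 hp
  exact ⟨(p, q), D.upper_double p q hq, rfl⟩

/-- The times at which the `i`-th component passes under a classical crossing. -/
def underTimes (i : Fin n) : Finset ℝ :=
  (D.finite_underPoints.toFinset.filter fun p => p.1 = i).image D.time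

/-- The arcs: the pair `(i, j)` stands for the arc `a_{i,j+1}`, the one which the `i`-th component
reaches after `j` classical under-crossings, so `(i, 0)` starts at the base point. This is the arc on
which the (not under-crossing) point `p` lies. -/
def arcOf (p : Fin n × UnitAddCircle) : Fin n × ℕ :=
  (p.1, ((D.underTimes p.1).filter fun t => t < D.time p).card)

/-- The list `(u_{i1}, ε_{i1}), (u_{i2}, ε_{i2}), …` of the over-passing arcs and the signs at the
classical under-crossings of the `i`-th component, in the order in which they are met from the base
point on. -/
def underWord (i : Fin n) : List ((Fin n × ℕ) × ℤˣ) :=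
  ((D.underTimes i).sort (· ≤ ·)).filterMap fun t =>
    let p : Fin n × UnitAddCircle := (i, D.base i + (t : UnitAddCircle))
    (D.upper p).map fun q => (D.arcOf q, D.sign p)

/-- The partial longitude `v_{ij} = u_{i1}^{ε_{i1}} ⋯ u_{ij}^{ε_{ij}}`, in the free group on the
arcs (letters `(i, j)` that do not name an arc never occur in it). -/
def partialLongitude (i : Fin n) (j : ℕ) : FreeGroup (Fin n × ℕ) :=
  (((D.underWord i).take j).map fun y => FreeGroup.of y.1 ^ ((y.2 : ℤˣ) : ℤ)).prod

/-- The homomorphisms `η_q`. The trivial homomorphism at `q = 0` is a convention, with which the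
recursion gives `η_1(a_{ij}) = α_i`. For `q ≥ 1` it gives `η_{q+1}(a_{i1}) = α_i` and
`η_{q+1}(a_{i,j+1}) = η_q(v_{ij})⁻¹ α_i η_q(v_{ij})`. -/
def eta : ℕ → (FreeGroup (Fin n × ℕ) →* FreeGroup (Fin n))
  | 0 => 1
  | q + 1 => FreeGroup.lift fun a =>
      (eta q (D.partialLongitude a.1 a.2))⁻¹ * FreeGroup.of a.1 *
        eta q (D.partialLongitude a.1 a.2)

/-- The sum `w_i` of the signs of the classical self-crossings of the `i`-th component. -/
def selfWrithe (i : Fin n) : ℤ :=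
  (((D.underWord i).filter fun y => y.1.1 = i).map fun y => ((y.2 : ℤˣ) : ℤ)).sum

/-- The preferred longitude `l_i = a_{i1}^{-w_i} v_{i m_i}`, where `m_i` is the number of classical
under-crossings of the `i`-th component. -/
def preferredLongitude (i : Fin n) : FreeGroup (Fin n × ℕ) :=
  FreeGroup.of (i, 0) ^ (-D.selfWrithe i) * D.partialLongitude i (D.underWord i).length

/-- `μ^{(q)}(j₁ … jₛ i)`: the coefficient of `X_{j₁} ⋯ X_{jₛ}` in `E(η_q(l_i))`, where `J` is the
list `[j₁, …, jₛ]`. -/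
def milnorAt (q : ℕ) (J : List (Fin n)) (i : Fin n) : ℤ :=
  (magnus (D.eta q (D.preferredLongitude i)) : NCSeries n) J

end BasedLinkDiagram

/-! ### Virtual string link diagrams -/

/-- The endpoint positions `0 < x₁ < ⋯ < xₙ < 1`. -/
structure EndPoints (n : ℕ) where
  pos : Fin n → ℝ
  strictMono : StrictMono pos
  mem_Ioo : ∀ i, pos i ∈ Ioo (0 : ℝ) 1

/-- The square `[0, 1] × [0, 1]`. -/
def square : Set (ℝ × ℝ) := Icc (0 : ℝ) 1 ×ˢ Icc (0 : ℝ) 1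

/-- The open square. -/
def openSquare : Set (ℝ × ℝ) := Ioo (0 : ℝ) 1 ×ˢ Ioo (0 : ℝ) 1

theorem openSquare_subset : openSquare ⊆ square :=
  prod_mono Ioo_subset_Icc_self Ioo_subset_Icc_self

/-- The determinant of two plane vectors. -/
def cross (v w : ℝ × ℝ) : ℝ := v.1 * w.2 - v.2 * w.1

/-- `(i, t)` is the point with parameter `t` of the `i`-th strand. Two different points of
`⊔ [0, 1]_i` with the same image form a double point. -/
def IsDouble {n : ℕ} (γ : Fin n → ℝ → ℝ × ℝ) (p q : Fin n × ℝ) : Prop :=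
  p.2 ∈ Icc (0 : ℝ) 1 ∧ q.2 ∈ Icc (0 : ℝ) 1 ∧ p ≠ q ∧ γ p.1 p.2 = γ q.1 q.2

/-- The tangent vector at a point of a strand. -/
def velocity {n : ℕ} (γ : Fin n → ℝ → ℝ × ℝ) (p : Fin n × ℝ) : ℝ × ℝ :=
  derivWithin (γ p.1) (Icc (0 : ℝ) 1) p.2

/-- An `n`-component virtual string link diagram: a smooth immersion of `n` intervals into the
square, the `i`-th one running from `(x_i, 0)` to `(x_i, 1)` (through the interior of the square, and
transverse to its boundary), with finitely many multiple points, all of them transverse double points.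
`upper p = some q` says that there is a classical crossing with lower strand at `p` and upper
strand at `q`; the double points without this information are the virtual crossings. The values of
the curves outside of `[0, 1]` are irrelevant. -/
structure StringLinkDiagram {n : ℕ} (x : EndPoints n) where
  curve : Fin n → ℝ → ℝ × ℝ
  smooth : ∀ i, ContDiffOn ℝ ∞ (curve i) (Icc 0 1)
  immersed : ∀ i, ∀ t ∈ Icc (0 : ℝ) 1, velocity curve (i, t) ≠ 0
  start : ∀ i, curve i 0 = (x.pos i, 0)
  finish : ∀ i, curve i 1 = (x.pos i, 1)
  inside : ∀ i, ∀ t ∈ Ioo (0 : ℝ) 1, curve i t ∈ openSquare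
  start_transverse : ∀ i, 0 < (velocity curve (i, 0)).2
  finish_transverse : ∀ i, 0 < (velocity curve (i, 1)).2
  finite_double : {z : (Fin n × ℝ) × (Fin n × ℝ) | IsDouble curve z.1 z.2}.Finite
  transverse : ∀ p q, IsDouble curve p q → cross (velocity curve p) (velocity curve q) ≠ 0
  no_triple : ∀ p q r, IsDouble curve p q → IsDouble curve p r → q = r
  upper : Fin n × ℝ → Option (Fin n × ℝ)
  upper_double : ∀ p q, upper p = some q → IsDouble curve p q
  upper_upper : ∀ p q, upper p = some q → upper q = none

namespace StringLinkDiagram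

variable {n : ℕ} {x : EndPoints n} (S : StringLinkDiagram x)

/-- The image of a point of a strand. -/
def point (p : Fin n × ℝ) : ℝ × ℝ := S.curve p.1 p.2

/-- The sense of rotation from the strand at `p` to the strand at `q` at a double point. -/
def rot (p q : Fin n × ℝ) : ℤˣ :=
  if 0 < cross (velocity S.curve p) (velocity S.curve q) then 1 else -1

/-- The sign of the classical crossing with lower strand at `p`: it is `1` if and only if the
direction of the upper strand followed by the direction of the lower strand is a positive basis. -/
def crossingSign (p : Fin n × ℝ) : ℤˣ :=
  match S.upper p with
  | some q => S.rot q p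
  | none => 1

/-- The virtual crossings. -/
def IsVirtual (p q : Fin n × ℝ) : Prop :=
  IsDouble S.curve p q ∧ S.upper p = none ∧ S.upper q = none

theorem mem_square (i : Fin n) {t : ℝ} (ht : t ∈ Icc (0 : ℝ) 1) : S.curve i t ∈ square := by
  rcases eq_or_lt_of_le ht.1 with h | h
  · rw [← h, S.start]
    exact ⟨⟨(x.mem_Ioo i).1.le, (x.mem_Ioo i).2.le⟩, by simp⟩
  · rcases eq_or_lt_of_le ht.2 with h' | h'
    · rw [h', S.finish]
      exact ⟨⟨(x.mem_Ioo i).1.le, (x.mem_Ioo i).2.le⟩, by simp⟩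
    · exact openSquare_subset (S.inside i t ⟨h, h'⟩)

end StringLinkDiagram

/-! ### The closure of a string link diagram -/

/-- Points on the boundary of the square are identified if they have the same first coordinate. -/
def closureSetoid : Setoid square where
  r z w := z = w ∨ (z.1 ∉ openSquare ∧ w.1 ∉ openSquare ∧ z.1.1 = w.1.1)
  iseqv :=
    { refl := fun _ => Or.inl rfl
      symm := by
        rintro z w (h | ⟨h1, h2, h3⟩)
        · exact Or.inl h.symm
        · exact Or.inr ⟨h2, h1, h3.symm⟩
      trans := by
        rintro z w v (h | ⟨h1, h2, h3⟩) (h' | ⟨h1', h2', h3'⟩)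
        · exact Or.inl (h.trans h')
        · subst h
          exact Or.inr ⟨h1', h2', h3'⟩
        · subst h'
          exact Or.inr ⟨h1, h2, h3⟩
        · exact Or.inr ⟨h1, h2', h3.trans h3'⟩ }

/-- The square with its boundary folded onto `[0, 1]` by the first projection (a sphere). -/
abbrev ClosedSquare : Type := Quotient closureSetoid

/-- The representative in `[0, 1)` of a point of the circle `ℝ/ℤ`. -/
def lift (c : UnitAddCircle) : ℝ := (AddCircle.equivIco (1 : ℝ) 0 c : ℝ)

theorem lift_mem (c : UnitAddCircle) : lift c ∈ Ico (0 : ℝ) 1 := by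
  have h : lift c ∈ Ico (0 : ℝ) (0 + 1) := (AddCircle.equivIco (1 : ℝ) 0 c).2
  rwa [zero_add] at h

theorem lift_mem_Icc (c : UnitAddCircle) : lift c ∈ Icc (0 : ℝ) 1 :=
  Ico_subset_Icc_self (lift_mem c)

theorem coe_lift (c : UnitAddCircle) : ((lift c : ℝ) : UnitAddCircle) = c :=
  AddCircle.coe_equivIco (p := (1 : ℝ)) (a := 0)

theorem lift_coe {t : ℝ} (ht : t ∈ Ico (0 : ℝ) 1) : lift (t : UnitAddCircle) = t := by
  have h : t ∈ Ico (0 : ℝ) (0 + 1) := by rwa [zero_add]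
  exact congrArg Subtype.val (AddCircle.equivIco_coe_eq (p := (1 : ℝ)) (a := 0) h)

theorem lift_injective : Function.Injective lift := fun c d h => by
  rw [← coe_lift c, h, coe_lift]

namespace StringLinkDiagram

variable {n : ℕ} {x : EndPoints n} (S : StringLinkDiagram x)

/-- The closed strands in the folded square. -/
def closedCurve (i : Fin n) (c : UnitAddCircle) : ClosedSquare :=
  Quotient.mk closureSetoid ⟨S.curve i (lift c), S.mem_square i (lift_mem_Icc c)⟩

theorem continuous_closedCurve (i : Fin n) : Continuous (S.closedCurve i) := by
  let f : ℝ → ClosedSquare := fun t =>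
    Quotient.mk closureSetoid ⟨S.curve i (projIcc 0 1 zero_le_one t),
      S.mem_square i (projIcc (0 : ℝ) 1 zero_le_one t).2⟩
  have hf : Continuous f := by
    refine continuous_quotient_mk'.comp (Continuous.subtype_mk ?_ _)
    exact (S.smooth i).continuousOn.comp_continuous
      (continuous_subtype_val.comp continuous_projIcc) fun t => (projIcc (0 : ℝ) 1 _ t).2
  have h : S.closedCurve i = AddCircle.liftIco (1 : ℝ) 0 f := by
    funext c
    have hc : lift c ∈ Ico (0 : ℝ) (0 + 1) := by
      rw [zero_add]
      exact lift_mem c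
    conv_rhs => rw [← coe_lift c]
    rw [AddCircle.liftIco_coe_apply hc]
    simp only [closedCurve, f, projIcc_of_mem zero_le_one (lift_mem_Icc c)]
  rw [h]
  refine AddCircle.liftIco_continuous ?_ hf.continuousOn
  refine Quotient.sound (Or.inr ?_)
  simp [projIcc_left, S.start, S.finish, openSquare]

theorem closedCurve_eq {i k : Fin n} {c d : UnitAddCircle} (hne : (i, c) ≠ (k, d))
    (h : S.closedCurve i c = S.closedCurve k d) :
    IsDouble S.curve (i, lift c) (k, lift d) ∧ lift c ≠ 0 ∧ lift d ≠ 0 := by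
  have hne' : (i, lift c) ≠ (k, lift d) := by
    intro e
    have e1 : i = k := congrArg Prod.fst e
    have e2 : lift c = lift d := congrArg Prod.snd e
    exact hne (by rw [e1, lift_injective e2])
  have bd : ∀ (j : Fin n) (a : UnitAddCircle), lift a = 0 → S.curve j (lift a) ∉ openSquare := by
    intro j a ha
    simp [ha, S.start, openSquare]
  have ins : ∀ (j : Fin n) (a : UnitAddCircle), lift a ≠ 0 → S.curve j (lift a) ∈ openSquare :=
    fun j a ha => S.inside j _ ⟨lt_of_le_of_ne (lift_mem a).1 (Ne.symm ha), (lift_mem a).2⟩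
  have both : ¬ (lift c = 0 ∧ lift d = 0 ∧ (S.curve i (lift c)).1 = (S.curve k (lift d)).1) := by
    rintro ⟨h1, h2, h3⟩
    rw [h1, h2, S.start, S.start] at h3
    exact hne' (by rw [h1, h2, x.strictMono.injective h3])
  rcases Quotient.exact h with h | ⟨h1, h2, h3⟩
  · have h' : S.curve i (lift c) = S.curve k (lift d) := congrArg Subtype.val h
    refine ⟨⟨lift_mem_Icc c, lift_mem_Icc d, hne', h'⟩, fun h0 => ?_, fun h0 => ?_⟩
    · by_cases h0' : lift d = 0
      · exact both ⟨h0, h0', congrArg Prod.fst h'⟩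
      · exact bd i c h0 (h' ▸ ins k d h0')
    · by_cases h0' : lift c = 0
      · exact both ⟨h0', h0, congrArg Prod.fst h'⟩
      · exact bd k d h0 (h' ▸ ins i c h0')
  · exfalso
    refine both ⟨?_, ?_, h3⟩
    · by_contra h0
      exact h1 (ins i c h0)
    · by_contra h0
      exact h2 (ins k d h0)

theorem closedCurve_of_isDouble {p q : Fin n × ℝ} (h : IsDouble S.curve p q) :
    q.2 ∈ Ioo (0 : ℝ) 1 := by
  obtain ⟨hp, hq, hne, he⟩ := h
  have end0 : ∀ (j : Fin n) (t : ℝ), t ∈ Icc (0 : ℝ) 1 → (S.curve j t).2 = 0 → t = 0 := by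
    intro j t ht h0
    by_contra h1
    rcases eq_or_lt_of_le ht.2 with h' | h'
    · rw [h', S.finish] at h0
      simp at h0
    · exact absurd h0 (S.inside j t ⟨lt_of_le_of_ne ht.1 (Ne.symm h1), h'⟩).2.1.ne'
  have end1 : ∀ (j : Fin n) (t : ℝ), t ∈ Icc (0 : ℝ) 1 → (S.curve j t).2 = 1 → t = 1 := by
    intro j t ht h0
    by_contra h1
    rcases eq_or_lt_of_le ht.1 with h' | h'
    · rw [← h', S.start] at h0
      simp at h0
    · exact absurd h0 (S.inside j t ⟨h', lt_of_le_of_ne ht.2 h1⟩).2.2.ne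
  refine ⟨lt_of_le_of_ne hq.1 fun h0 => ?_, lt_of_le_of_ne hq.2 fun h0 => ?_⟩
  · rw [← h0, S.start] at he
    have hp0 := end0 p.1 p.2 hp (by rw [he])
    rw [hp0, S.start] at he
    exact hne (Prod.ext (x.strictMono.injective (congrArg Prod.fst he)) (hp0.trans h0))
  · rw [h0, S.finish] at he
    have hp0 := end1 p.1 p.2 hp (by rw [he])
    rw [hp0, S.finish] at he
    exact hne (Prod.ext (x.strictMono.injective (congrArg Prod.fst he)) (hp0.trans h0.symm))

/-- The closure `(D_S, p_S)`: the strands are closed up in the folded square, crossings and signs are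
those of `S`, and the base points are the closed-up endpoints. -/
def closure : BasedLinkDiagram n ClosedSquare where
  curve := S.closedCurve
  continuous_curve := S.continuous_closedCurve
  finite_double := by
    refine Finite.of_finite_image (f := fun z => ((z.1.1, lift z.1.2), (z.2.1, lift z.2.2)))
      (S.finite_double.subset ?_) ?_
    · rintro _ ⟨⟨⟨i, c⟩, ⟨k, d⟩⟩, ⟨hne, h⟩, rfl⟩
      exact (S.closedCurve_eq hne h).1
    · rintro ⟨⟨i, c⟩, ⟨k, d⟩⟩ - ⟨⟨i', c'⟩, ⟨k', d'⟩⟩ - h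
      simp only [Prod.mk.injEq] at h
      obtain ⟨⟨rfl, h1⟩, rfl, h2⟩ := h
      rw [lift_injective h1, lift_injective h2]
  no_triple := by
    rintro ⟨i, c⟩ ⟨k, d⟩ ⟨l, e⟩ h1 h2 h3 h4
    have h := S.no_triple _ _ _ (S.closedCurve_eq h1 h3).1 (S.closedCurve_eq h2 h4).1
    simp only [Prod.mk.injEq] at h
    obtain ⟨rfl, h⟩ := h
    rw [lift_injective h]
  upper := fun p => (S.upper (p.1, lift p.2)).map fun q => (q.1, (q.2 : UnitAddCircle))
  upper_double := by
    rintro ⟨i, c⟩ ⟨k, d⟩ h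
    obtain ⟨⟨k', s⟩, h1, h2⟩ := Option.map_eq_some_iff.1 h
    have hd := S.upper_double _ _ h1
    have hs := S.closedCurve_of_isDouble hd
    obtain ⟨-, -, hne, he⟩ := hd
    simp only [Prod.mk.injEq] at h2
    obtain ⟨rfl, rfl⟩ := h2
    have hl : lift (s : UnitAddCircle) = s := lift_coe (Ioo_subset_Ico_self hs)
    refine ⟨?_, ?_⟩
    · intro e
      simp only [Prod.mk.injEq] at e
      obtain ⟨rfl, rfl⟩ := e
      exact hne (by rw [hl])
    · simp only [closedCurve, hl]
      exact congrArg _ (Subtype.ext he)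
  upper_upper := by
    rintro ⟨i, c⟩ ⟨k, d⟩ h
    obtain ⟨⟨k', s⟩, h1, h2⟩ := Option.map_eq_some_iff.1 h
    have hs := S.closedCurve_of_isDouble (S.upper_double _ _ h1)
    simp only [Prod.mk.injEq] at h2
    obtain ⟨rfl, rfl⟩ := h2
    simp only [lift_coe (Ioo_subset_Ico_self hs), S.upper_upper _ _ h1, Option.map_none]
  sign := fun p => S.crossingSign (p.1, lift p.2)
  base := fun _ => ((0 : ℝ) : UnitAddCircle)
  base_not_double := by
    rintro i ⟨k, d⟩ hne h
    exact (S.closedCurve_eq hne h).2.2 (lift_coe ⟨le_rfl, one_pos⟩)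

/-- `μ_S^{(q)}(j₁ … jₛ i)`, for `J = [j₁, …, jₛ]`. -/
def milnorAt (q : ℕ) (J : List (Fin n)) (i : Fin n) : ℤ := S.closure.milnorAt q J i

/-- The Milnor number `μ_S(j₁ … jₛ i)`, the value `μ_S^{(q)}(j₁ … jₛ i)` at `q = s + 1`. -/
def milnor (J : List (Fin n)) (i : Fin n) : ℤ := S.milnorAt (J.length + 1) J i

/-! ### Welded isotopy -/

/-- `S'` arises from `S` by an orientation preserving diffeomorphism `h` of the square that fixes the
boundary pointwise, and by reparametrizing the strands. -/
def PlanarIsotopic (S S' : StringLinkDiagram x) : Prop :=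
  ∃ (h k : ℝ × ℝ → ℝ × ℝ) (ψ : Fin n → ℝ → ℝ),
    ContDiffOn ℝ ∞ h square ∧ ContDiffOn ℝ ∞ k square ∧
    MapsTo h square square ∧ MapsTo k square square ∧ InvOn k h square square ∧
    (∀ z ∈ square \ openSquare, h z = z) ∧
    (∀ z ∈ openSquare, 0 < (fderiv ℝ h z).det) ∧
    (∀ i, ContDiffOn ℝ ∞ (ψ i) (Icc 0 1) ∧ ψ i 0 = 0 ∧ ψ i 1 = 1 ∧
      ∀ t ∈ Icc (0 : ℝ) 1, 0 < derivWithin (ψ i) (Icc (0 : ℝ) 1) t) ∧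
    (∀ i, ∀ t ∈ Icc (0 : ℝ) 1, S'.curve i t = h (S.curve i (ψ i t))) ∧
    (∀ i j, ∀ t ∈ Icc (0 : ℝ) 1, ∀ s ∈ Icc (0 : ℝ) 1,
      S'.upper (i, t) = some (j, s) ↔ S.upper (i, ψ i t) = some (j, ψ j s))

end StringLinkDiagram

/-- `m` subintervals of the strands: the `k`-th one is `[a k, b k]` on the strand `comp k`. -/
structure Arcs (n m : ℕ) where
  comp : Fin m → Fin n
  a : Fin m → ℝ
  b : Fin m → ℝ

namespace Arcs

variable {n m : ℕ} (A : Arcs n m)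

def closedArc (k : Fin m) : Set (Fin n × ℝ) := {p | p.1 = A.comp k ∧ p.2 ∈ Icc (A.a k) (A.b k)}

def openArc (k : Fin m) : Set (Fin n × ℝ) := {p | p.1 = A.comp k ∧ p.2 ∈ Ioo (A.a k) (A.b k)}

end Arcs

namespace StringLinkDiagram

variable {n : ℕ} {x : EndPoints n}

/-- The part of the diagram `S` in the disk `δ` consists of the arcs `A`, each of them having its
ends on the boundary of `δ` and running through the interior of `δ`. -/
def MeetsDiskIn {m : ℕ} (S : StringLinkDiagram x) (δ : Set (ℝ × ℝ)) (A : Arcs n m) : Prop :=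
  ∀ p : Fin n × ℝ, p.2 ∈ Icc (0 : ℝ) 1 →
    (S.point p ∈ δ ↔ ∃ k, p ∈ A.closedArc k) ∧
    (S.point p ∈ interior δ ↔ ∃ k, p ∈ A.openArc k)

/-- `S` and `S'` coincide outside a closed disk `δ`, in which both consist of `m` disjoint arcs. -/
def DifferInDisk {m : ℕ} (S S' : StringLinkDiagram x) (δ : Set (ℝ × ℝ)) (A : Arcs n m) : Prop :=
  δ ⊆ openSquare ∧ Nonempty (Metric.closedBall (0 : ℂ) 1 ≃ₜ δ) ∧
  (∀ k, 0 < A.a k ∧ A.a k < A.b k ∧ A.b k < 1) ∧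
  (∀ k l, k ≠ l → Disjoint (A.closedArc k) (A.closedArc l)) ∧
  S.MeetsDiskIn δ A ∧ S'.MeetsDiskIn δ A ∧
  ∀ p : Fin n × ℝ, p.2 ∈ Icc (0 : ℝ) 1 → (∀ k, p ∉ A.closedArc k) →
    S.point p = S'.point p ∧ S.upper p = S'.upper p

/-- The double points of `S` on the arcs `A`, as ordered pairs. -/
def doublesOn {m : ℕ} (S : StringLinkDiagram x) (A : Arcs n m) :
    Set ((Fin n × ℝ) × (Fin n × ℝ)) :=
  {z | IsDouble S.curve z.1 z.2 ∧ ∃ k, z.1 ∈ A.closedArc k}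

/-- In the disk, `S` is an arc without a double point and `S'` is an arc with a single double point,
which satisfies `P`. -/
def CurlMove (P : StringLinkDiagram x → Fin n × ℝ → Fin n × ℝ → Prop)
    (S S' : StringLinkDiagram x) : Prop :=
  ∃ (δ : Set (ℝ × ℝ)) (A : Arcs n 1) (p q : Fin n × ℝ), S.DifferInDisk S' δ A ∧
    S.doublesOn A = ∅ ∧
    p ∈ A.openArc 0 ∧ q ∈ A.openArc 0 ∧ S'.doublesOn A = {(p, q), (q, p)} ∧ P S' p q

/-- In the disk, `S` consists of two arcs without double points, and `S'` of two arcs which form a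
bigon: they cross each other at `p₁, q₁` and at `p₂, q₂`, in opposite senses, and have no other
double point. The two crossings satisfy `P`. -/
def BigonMove (P : StringLinkDiagram x → Fin n × ℝ → Fin n × ℝ → Prop)
    (S S' : StringLinkDiagram x) : Prop :=
  ∃ (δ : Set (ℝ × ℝ)) (A : Arcs n 2) (p₁ p₂ q₁ q₂ : Fin n × ℝ), S.DifferInDisk S' δ A ∧
    S.doublesOn A = ∅ ∧
    p₁ ∈ A.openArc 0 ∧ p₂ ∈ A.openArc 0 ∧ q₁ ∈ A.openArc 1 ∧ q₂ ∈ A.openArc 1 ∧ p₁ ≠ p₂ ∧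
    S'.doublesOn A = {(p₁, q₁), (q₁, p₁), (p₂, q₂), (q₂, p₂)} ∧
    S'.rot p₁ q₁ = -S'.rot p₂ q₂ ∧ P S' p₁ q₁ ∧ P S' p₂ q₂

/-- `S` consists on the arcs `A` of three arcs which cross each other pairwise once, so that they
form a triangle: `c i j` is the point of the `i`-th arc at which it crosses the `j`-th one. The last
clause (indices modulo 3) records how the senses in which two arcs cross each other
and the orders in which an arc meets the other two determine each other for a triangle in a disk. -/
def IsTriangle (S : StringLinkDiagram x) (A : Arcs n 3) (c : Fin 3 → Fin 3 → Fin n × ℝ) : Prop :=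
  (∀ i j, i ≠ j → c i j ∈ A.openArc i) ∧
  S.doublesOn A = {z | ∃ i j, i ≠ j ∧ z = (c i j, c j i)} ∧
  ∀ i j, ((c i (i + 1)).2 < (c i (i + 2)).2 ↔ (c j (j + 1)).2 < (c j (j + 2)).2) ↔
    S.rot (c (i + 1) (i + 2)) (c (i + 2) (i + 1)) = S.rot (c (j + 1) (j + 2)) (c (j + 2) (j + 1))

/-- In the disk, `S` and `S'` consist of three arcs that form a triangle, and `S'` is obtained by
moving each arc across the crossing of the other two: crossings keep their senses, and each arc meets
the other two in the opposite order. The crossings of both satisfy `P`. -/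
def TriangleMove (P : StringLinkDiagram x → (Fin 3 → Fin 3 → Fin n × ℝ) → Prop)
    (S S' : StringLinkDiagram x) : Prop :=
  ∃ (δ : Set (ℝ × ℝ)) (A : Arcs n 3) (c c' : Fin 3 → Fin 3 → Fin n × ℝ), S.DifferInDisk S' δ A ∧
    S.IsTriangle A c ∧ S'.IsTriangle A c' ∧
    (∀ i j, i ≠ j → S.rot (c i j) (c j i) = S'.rot (c' i j) (c' j i)) ∧
    (∀ i j k, i ≠ j → j ≠ k → k ≠ i → ((c i j).2 < (c i k).2 ↔ (c' i k).2 < (c' i j).2)) ∧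
    P S c ∧ P S' c'

/-- There is a classical crossing at which the strand at `p` is above the strand at `q`. -/
def Above (S : StringLinkDiagram x) (p q : Fin n × ℝ) : Prop := S.upper q = some p

/-- The welded Reidemeister moves, each in one of its two directions. -/
inductive WeldedMove : StringLinkDiagram x → StringLinkDiagram x → Prop
  | R1 {S S' : StringLinkDiagram x} : CurlMove Above S S' → WeldedMove S S'
  | R2 {S S' : StringLinkDiagram x} : BigonMove Above S S' → WeldedMove S S'
  | R3 {S S' : StringLinkDiagram x} :
      TriangleMove (fun T c => T.Above (c 0 1) (c 1 0) ∧ T.Above (c 0 2) (c 2 0) ∧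
        T.Above (c 1 2) (c 2 1)) S S' → WeldedMove S S'
  | V1 {S S' : StringLinkDiagram x} : CurlMove IsVirtual S S' → WeldedMove S S'
  | V2 {S S' : StringLinkDiagram x} : BigonMove IsVirtual S S' → WeldedMove S S'
  | V3 {S S' : StringLinkDiagram x} :
      TriangleMove (fun T c => T.IsVirtual (c 0 1) (c 1 0) ∧ T.IsVirtual (c 0 2) (c 2 0) ∧
        T.IsVirtual (c 1 2) (c 2 1)) S S' → WeldedMove S S'
  | V4 {S S' : StringLinkDiagram x} :
      TriangleMove (fun T c => T.IsVirtual (c 0 1) (c 1 0) ∧ T.IsVirtual (c 0 2) (c 2 0) ∧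
        T.Above (c 1 2) (c 2 1)) S S' → WeldedMove S S'
  | OC {S S' : StringLinkDiagram x} :
      TriangleMove (fun T c => T.Above (c 0 1) (c 1 0) ∧ T.Above (c 0 2) (c 2 0) ∧
        T.IsVirtual (c 1 2) (c 2 1)) S S' → WeldedMove S S'

/-- Welded isotopy: the equivalence relation generated by planar isotopies and the welded
Reidemeister moves. -/
def WeldedIsotopic : StringLinkDiagram x → StringLinkDiagram x → Prop :=
  Relation.EqvGen fun S S' => PlanarIsotopic S S' ∨ WeldedMove S S'

end StringLinkDiagram

end WeldedMilnor

end

/-! Conjugation gains precision: if two units agree below degree `j`, their conjugates of `1 + X_i`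
agree below degree `j + 1`, because the constant term is unaffected and `X_i` has degree one
(`truncate_succ_conj`). By induction the expansions of `η_q` and `η_{q+1}` agree below degree `q`,
so they converge to a homomorphism `etaLimit` that agrees with `E ∘ η_q` below degree `q`. A
coefficient of degree `s < q` is therefore a coefficient of the limit, which gives independence of
`q`.

For invariance, the limit is described without arcs or their numbering. A longitude function `ν` on
the points of the strands starts at `1`, is locally constant away from classical under-crossings,
and at an under-crossing of sign `ε` is multiplied on the right by the `ε`-th power of the colour
`ν⁻¹ (1 + X_k) ν` of the over-strand, where `k` is its component. At a self-crossing of component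
`i` it is also multiplied on the left by `(1 + X_i) ^ (-ε)`, which leaves colours unchanged and
accounts for the framing correction. Its value at `(i, 1)` is the image of the preferred longitude.

The over-strand may be met later than the under-crossing, so `ν` cannot be computed by travelling
along the strands alone. But knowing `ν` below degree `j` gives all colours below degree `j + 1`;
hence an induction on the degree, with an induction along the strand (`Icc_induction`) inside,
proves uniqueness (`IsLongitude.unique`). The same double induction shows that diagrams differing in
a disk have the same final longitudes as soon as `ν` changes by the same formula along each arc in
the disk (`DifferInDisk.longitude_eq`). For every welded move this is a short computation in a
group; for planar isotopies the longitude function is transported and uniqueness applies. -/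

noncomputable section

namespace WeldedMilnor

/-! ### The filtration of the power series ring by degree -/

namespace NCSeries

variable {n : ℕ}

/-- The series without terms of degree less than `j`. -/
def VanishBelow (j : ℕ) (f : NCSeries n) : Prop := ∀ w : List (Fin n), w.length < j → f w = 0

theorem sub_apply (f g : NCSeries n) (w : List (Fin n)) : (f - g) w = f w - g w := rfl

theorem neg_apply (f : NCSeries n) (w : List (Fin n)) : (-f) w = -f w := rfl

theorem VanishBelow.add {j : ℕ} {f g : NCSeries n} (hf : VanishBelow j f) (hg : VanishBelow j g) :
    VanishBelow j (f + g) := fun w hw => by rw [add_apply, hf w hw, hg w hw, add_zero]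

theorem VanishBelow.neg {j : ℕ} {f : NCSeries n} (hf : VanishBelow j f) : VanishBelow j (-f) :=
  fun w hw => by rw [neg_apply, hf w hw, neg_zero]

theorem VanishBelow.mul {j k : ℕ} {f g : NCSeries n} (hf : VanishBelow j f)
    (hg : VanishBelow k g) : VanishBelow (j + k) (f * g) := fun w hw => by
  rw [mul_apply]
  refine Finset.sum_eq_zero fun m hm => ?_
  rw [Finset.mem_range] at hm
  by_cases h : m < j
  · rw [hf _ (by rw [List.length_take]; omega), zero_mul]
  · rw [hg _ (by rw [List.length_drop]; omega), mul_zero]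

theorem vanishBelow_zero (f : NCSeries n) : VanishBelow 0 f := fun _ hw => absurd hw (by omega)

theorem VanishBelow.mul_left {j : ℕ} {f : NCSeries n} (hf : VanishBelow j f) (g : NCSeries n) :
    VanishBelow j (g * f) := by
  simpa using (vanishBelow_zero g).mul hf

theorem VanishBelow.mul_right {j : ℕ} {f : NCSeries n} (hf : VanishBelow j f) (g : NCSeries n) :
    VanishBelow j (f * g) := by
  simpa using hf.mul (vanishBelow_zero g)

/-- The units that are `1` up to terms of degree at least `j`. -/
def unitFiltration (n j : ℕ) : Subgroup (NCSeries n)ˣ where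
  carrier := {u | VanishBelow j ((u : NCSeries n) - 1)}
  one_mem' := fun w _ => by simp [zero_apply]
  mul_mem' := fun {u v} hu hv => by
    have h : ((u * v : (NCSeries n)ˣ) : NCSeries n) - 1 = ((u : NCSeries n) - 1) * v + (v - 1) := by
      rw [Units.val_mul]; noncomm_ring
    rw [mem_ofPred_eq, h]
    exact (hu.mul_right _).add hv
  inv_mem' := fun {u} hu => by
    have h : ((u⁻¹ : (NCSeries n)ˣ) : NCSeries n) - 1 = -((u⁻¹ : (NCSeries n)ˣ) * ((u : NCSeries n) - 1)) := by
      rw [mul_sub, Units.inv_mul]; noncomm_ring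
    rw [mem_ofPred_eq, h]
    exact (hu.mul_left _).neg

instance (j : ℕ) : (unitFiltration n j).Normal where
  conj_mem := fun u hu g => by
    have h : ((g * u * g⁻¹ : (NCSeries n)ˣ) : NCSeries n) - 1 =
        g * ((u : NCSeries n) - 1) * (g⁻¹ : (NCSeries n)ˣ) := by
      rw [mul_sub, sub_mul, mul_one, Units.mul_inv, Units.val_mul, Units.val_mul]
    change VanishBelow j _
    rw [h]
    exact (VanishBelow.mul_left hu _).mul_right _

/-- The class of a unit up to terms of degree at least `j`. -/
def truncate (j : ℕ) : (NCSeries n)ˣ →* (NCSeries n)ˣ ⧸ unitFiltration n j := QuotientGroup.mk' _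

theorem truncate_eq_iff {j : ℕ} {u v : (NCSeries n)ˣ} :
    truncate j u = truncate j v ↔ VanishBelow j ((v : NCSeries n) - (u : NCSeries n)) := by
  rw [truncate, QuotientGroup.mk'_apply, QuotientGroup.mk'_apply, QuotientGroup.eq]
  change VanishBelow j _ ↔ _
  have h : ((u⁻¹ * v : (NCSeries n)ˣ) : NCSeries n) - 1 = (u⁻¹ : (NCSeries n)ˣ) * ((v : NCSeries n) - (u : NCSeries n)) := by
    rw [mul_sub, Units.inv_mul, Units.val_mul]
  constructor
  · intro hv
    have h' := hv.mul_left (u : NCSeries n)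
    rwa [h, ← mul_assoc, Units.mul_inv, one_mul] at h'
  · intro hv
    rw [h]
    exact hv.mul_left _

theorem truncate_eq_iff_coeff {j : ℕ} {u v : (NCSeries n)ˣ} :
    truncate j u = truncate j v ↔
      ∀ w : List (Fin n), w.length < j → (u : NCSeries n) w = (v : NCSeries n) w := by
  rw [truncate_eq_iff]
  refine forall₂_congr fun w _ => ?_
  rw [sub_apply, sub_eq_zero, eq_comm]

theorem truncate_zero (u v : (NCSeries n)ˣ) : truncate 0 u = truncate 0 v :=
  truncate_eq_iff.2 (vanishBelow_zero _)

theorem eq_of_truncate_eq {u v : (NCSeries n)ˣ} (h : ∀ j, truncate j u = truncate j v) : u = v :=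
  Units.ext <| NCSeries.ext fun w =>
    truncate_eq_iff_coeff.1 (h (w.length + 1)) w (Nat.lt_succ_self _)

theorem truncate_of_le {j k : ℕ} (hjk : j ≤ k) {u v : (NCSeries n)ˣ}
    (h : truncate k u = truncate k v) : truncate j u = truncate j v :=
  truncate_eq_iff.2 fun w hw => truncate_eq_iff.1 h w (hw.trans_le hjk)

/-- Conjugating `1 + X_i` gains one degree of precision. -/
theorem truncate_succ_conj {j : ℕ} {u v : (NCSeries n)ˣ} (h : truncate j u = truncate j v)
    (i : Fin n) : truncate (j + 1) (u⁻¹ * unitOneAddX i * u) =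
      truncate (j + 1) (v⁻¹ * unitOneAddX i * v) := by
  have h' : truncate j u⁻¹ = truncate j v⁻¹ := by rw [map_inv, map_inv, h]
  rw [truncate_eq_iff] at h h' ⊢
  have hX : VanishBelow 1 ((unitOneAddX i : (NCSeries n)ˣ) - 1 : NCSeries n) := by
    intro w hw
    obtain rfl : w = [] := List.length_eq_zero_iff.1 (by omega)
    simp [sub_apply, unitOneAddX, oneAddX, one_apply]
  -- The constant term of `1 + X_i` cancels in the difference of the conjugates, so each remaining
  -- summand contains both `X_i` and a difference of degree at least `j`.
  have e : ((v⁻¹ * unitOneAddX i * v : (NCSeries n)ˣ) : NCSeries n) -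
      (u⁻¹ * unitOneAddX i * u : (NCSeries n)ˣ) =
      (((v⁻¹ : (NCSeries n)ˣ) : NCSeries n) - (u⁻¹ : (NCSeries n)ˣ)) *
          ((unitOneAddX i : (NCSeries n)ˣ) - 1) * v +
        (u⁻¹ : (NCSeries n)ˣ) * (((unitOneAddX i : (NCSeries n)ˣ) - 1) * ((v : NCSeries n) - (u : NCSeries n))) := by
    simp only [mul_sub, sub_mul, mul_one, one_mul, mul_assoc, Units.val_mul, Units.inv_mul]
    abel
  rw [e]
  refine ((h'.mul hX).mul_right _).add (VanishBelow.mul_left ?_ _)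
  rw [add_comm]
  exact hX.mul h

/-- The limit of a sequence of units that stabilizes in each degree, as a series. -/
def limitSeries (u : ℕ → (NCSeries n)ˣ) : NCSeries n := fun w => (u (w.length + 1) : NCSeries n) w

/-- The coefficient of a product at `w` involves only subwords of `w`, and on these both limits
agree with the terms of index `w.length + 1`. -/
theorem limitSeries_mul_limitSeries {u v : ℕ → (NCSeries n)ˣ}
    (hu : ∀ j k, j ≤ k → truncate j (u j) = truncate j (u k))
    (hv : ∀ j k, j ≤ k → truncate j (v j) = truncate j (v k)) (huv : ∀ j, u j * v j = 1) :
    limitSeries u * limitSeries v = 1 := by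
  ext w
  have h : ((u (w.length + 1) : NCSeries n) * (v (w.length + 1) : NCSeries n)) = 1 := by
    rw [← Units.val_mul, huv, Units.val_one]
  rw [← h, mul_apply, mul_apply]
  refine Finset.sum_congr rfl fun k _ => ?_
  congr 1
  · exact truncate_eq_iff_coeff.1 (hu _ _ (by simp)) _ (Nat.lt_succ_self _)
  · exact truncate_eq_iff_coeff.1 (hv _ _ (by simp)) _ (Nat.lt_succ_self _)

/-- The limit of a sequence of units that stabilizes in each degree. -/
def limitUnit (u : ℕ → (NCSeries n)ˣ)
    (h : ∀ j k, j ≤ k → truncate j (u j) = truncate j (u k)) : (NCSeries n)ˣ where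
  val := limitSeries u
  inv := limitSeries fun j => (u j)⁻¹
  val_inv := limitSeries_mul_limitSeries h
    (fun j k hjk => by rw [map_inv, map_inv, h j k hjk]) fun j => mul_inv_cancel (u j)
  inv_val := limitSeries_mul_limitSeries
    (fun j k hjk => by rw [map_inv, map_inv, h j k hjk]) h fun j => inv_mul_cancel (u j)

theorem truncate_limitUnit (u : ℕ → (NCSeries n)ˣ)
    (h : ∀ j k, j ≤ k → truncate j (u j) = truncate j (u k)) (j : ℕ) :
    truncate j (limitUnit u h) = truncate j (u j) :=
  truncate_eq_iff_coeff.2 fun w hw => truncate_eq_iff_coeff.1 (h _ _ hw) w (Nat.lt_succ_self _)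

end NCSeries

open NCSeries

theorem magnus_of {n : ℕ} (i : Fin n) : magnus (FreeGroup.of i) = unitOneAddX i :=
  FreeGroup.lift_apply_of

/-! ### The limit of the homomorphisms `η_q` -/

namespace BasedLinkDiagram

variable {n : ℕ} {X : Type} [TopologicalSpace X] (D : BasedLinkDiagram n X)

theorem eta_succ_of (q : ℕ) (a : Fin n × ℕ) : D.eta (q + 1) (FreeGroup.of a) =
    (D.eta q (D.partialLongitude a.1 a.2))⁻¹ * FreeGroup.of a.1 *
      D.eta q (D.partialLongitude a.1 a.2) := FreeGroup.lift_apply_of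

/-- Truncation is a homomorphism, so generators suffice. There both sides are conjugates of `1 +
X_i`, by elements that the induction hypothesis compares in one degree less. -/
theorem truncate_magnus_eta_succ (q : ℕ) (w : FreeGroup (Fin n × ℕ)) :
    truncate q (magnus (D.eta q w)) = truncate q (magnus (D.eta (q + 1) w)) := by
  induction q generalizing w with
  | zero => exact truncate_zero _ _
  | succ q ih =>
    have h : ((truncate (q + 1)).comp (magnus.comp (D.eta (q + 1)))) =
        (truncate (q + 1)).comp (magnus.comp (D.eta (q + 1 + 1))) := by
      ext a
      simp only [MonoidHom.comp_apply]
      rw [eta_succ_of, eta_succ_of]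
      simp only [map_mul magnus, map_inv magnus, magnus_of]
      exact truncate_succ_conj (ih _) _
    exact DFunLike.congr_fun h w

theorem truncate_magnus_eta {j k : ℕ} (hjk : j ≤ k) (w : FreeGroup (Fin n × ℕ)) :
    truncate j (magnus (D.eta j w)) = truncate j (magnus (D.eta k w)) := by
  induction k, hjk using Nat.le_induction with
  | base => rfl
  | succ k hk ih => rw [ih]; exact truncate_of_le hk (D.truncate_magnus_eta_succ k w)

/-- The limit of the Magnus expansions of the homomorphisms `η_q`. -/
def etaLimit : FreeGroup (Fin n × ℕ) →* (NCSeries n)ˣ :=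
  FreeGroup.lift fun a => limitUnit (fun q => magnus (D.eta q (FreeGroup.of a)))
    fun _ _ h => D.truncate_magnus_eta h _

theorem truncate_etaLimit (j : ℕ) (w : FreeGroup (Fin n × ℕ)) :
    truncate j (D.etaLimit w) = truncate j (magnus (D.eta j w)) := by
  have h : (truncate j).comp D.etaLimit = (truncate j).comp (magnus.comp (D.eta j)) := by
    ext a
    simp only [MonoidHom.comp_apply, etaLimit, FreeGroup.lift_apply_of]
    exact truncate_limitUnit _ _ j
  exact DFunLike.congr_fun h w

/-- The recursion for `η_q` becomes a fixed point equation in the limit; from here on the index `q`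
plays no role. -/
theorem etaLimit_of (a : Fin n × ℕ) : D.etaLimit (FreeGroup.of a) =
    (D.etaLimit (D.partialLongitude a.1 a.2))⁻¹ * unitOneAddX a.1 *
      D.etaLimit (D.partialLongitude a.1 a.2) := by
  refine eq_of_truncate_eq fun j => truncate_of_le (Nat.le_succ j) ?_
  rw [truncate_etaLimit, eta_succ_of]
  simp only [map_mul magnus, map_inv magnus, magnus_of]
  exact truncate_succ_conj (D.truncate_etaLimit j _).symm _

theorem milnorAt_eq {q : ℕ} {J : List (Fin n)} (h : J.length < q) (i : Fin n) :
    D.milnorAt q J i = (D.etaLimit (D.preferredLongitude i) : NCSeries n) J :=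
  (truncate_eq_iff_coeff.1 (D.truncate_etaLimit q _) J h).symm

end BasedLinkDiagram

open Filter Topology

/-! ### Longitude functions -/

namespace BasedLinkDiagram

variable {n : ℕ} {X : Type} [TopologicalSpace X] (D : BasedLinkDiagram n X)

/-- The sum of the signs of the self-crossings among the first `j` under-crossings. -/
def partialWrithe (i : Fin n) (j : ℕ) : ℤ :=
  ((((D.underWord i).take j).filter fun y => y.1.1 = i).map fun y => ((y.2 : ℤˣ) : ℤ)).sum

/-- The Magnus expansion of the partial longitude, corrected by the partial writhe. -/
def normalizedLongitude (i : Fin n) (j : ℕ) : (NCSeries n)ˣ :=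
  unitOneAddX i ^ (-D.partialWrithe i j) * D.etaLimit (D.partialLongitude i j)

theorem partialLongitude_zero (i : Fin n) : D.partialLongitude i 0 = 1 := by
  simp [partialLongitude]

theorem normalizedLongitude_zero (i : Fin n) : D.normalizedLongitude i 0 = 1 := by
  simp [normalizedLongitude, partialLongitude, partialWrithe]

/-- The writhe correction is a power of `1 + X_i`, which commutes with the element being conjugated.
Normalized longitudes therefore determine the colours and satisfy a recursion of their own. -/
theorem etaLimit_of_eq_conj (a : Fin n × ℕ) : D.etaLimit (FreeGroup.of a) =
    (D.normalizedLongitude a.1 a.2)⁻¹ * unitOneAddX a.1 * D.normalizedLongitude a.1 a.2 := by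
  rw [etaLimit_of, normalizedLongitude]
  group

theorem normalizedLongitude_succ {i : Fin n} {j : ℕ} {y : (Fin n × ℕ) × ℤˣ}
    (h : (D.underWord i)[j]? = some y) :
    D.normalizedLongitude i (j + 1) =
      unitOneAddX i ^ (-(if y.1.1 = i then (y.2 : ℤ) else 0)) * D.normalizedLongitude i j *
        ((D.normalizedLongitude y.1.1 y.1.2)⁻¹ * unitOneAddX y.1.1 *
          D.normalizedLongitude y.1.1 y.1.2) ^ (y.2 : ℤ) := by
  have hl : D.partialLongitude i (j + 1) =
      D.partialLongitude i j * FreeGroup.of y.1 ^ ((y.2 : ℤˣ) : ℤ) := by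
    simp [partialLongitude, List.take_add_one, h]
  have hw : D.partialWrithe i (j + 1) =
      D.partialWrithe i j + if y.1.1 = i then (y.2 : ℤ) else 0 := by
    simp only [partialWrithe, List.take_add_one, h, Option.toList_some, List.filter_append,
      List.map_append, List.sum_append]
    by_cases hy : y.1.1 = i <;> simp [hy]
  rw [← etaLimit_of_eq_conj, normalizedLongitude, normalizedLongitude, hl, hw, map_mul, map_zpow,
    neg_add_rev, zpow_add]
  simp only [mul_assoc]

/-- The arc at the base point has colour `1 + X_i`, so the factor `a_{i1}^{-w_i}` becomes the writhe
correction. Any `j` beyond the end of the word is allowed, since `take` then returns the whole word.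
-/
theorem etaLimit_preferredLongitude {i : Fin n} {j : ℕ} (hj : (D.underWord i).length ≤ j) :
    D.etaLimit (D.preferredLongitude i) = D.normalizedLongitude i j := by
  have hl : D.partialLongitude i j = D.partialLongitude i (D.underWord i).length := by
    rw [partialLongitude, partialLongitude, List.take_of_length_le hj, List.take_length]
  have hw : D.partialWrithe i j = D.selfWrithe i := by
    rw [partialWrithe, selfWrithe, List.take_of_length_le hj]
  rw [normalizedLongitude, hl, hw, preferredLongitude, map_mul, map_zpow, etaLimit_of,
    partialLongitude_zero]
  simp

end BasedLinkDiagram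

/-! ### From words in the arcs to functions on the strands -/

namespace StringLinkDiagram

variable {n : ℕ} {x : EndPoints n} (S : StringLinkDiagram x)

theorem mem_Ioo_of_upper {p q : Fin n × ℝ} (h : S.upper p = some q) :
    p.2 ∈ Ioo (0 : ℝ) 1 ∧ q.2 ∈ Ioo (0 : ℝ) 1 := by
  have hd := S.upper_double _ _ h
  exact ⟨S.closedCurve_of_isDouble ⟨hd.2.1, hd.1, hd.2.2.1.symm, hd.2.2.2.symm⟩,
    S.closedCurve_of_isDouble hd⟩

theorem closure_time (i : Fin n) (c : UnitAddCircle) : S.closure.time (i, c) = lift c := by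
  simp [BasedLinkDiagram.time, closure, lift]

theorem mem_underTimes {i : Fin n} {t : ℝ} :
    t ∈ S.closure.underTimes i ↔ S.upper (i, t) ≠ none := by
  simp only [BasedLinkDiagram.underTimes, Finset.mem_image, Finset.mem_filter,
    Set.Finite.mem_toFinset, BasedLinkDiagram.underPoints, mem_ofPred_eq]
  constructor
  · rintro ⟨⟨k, c⟩, ⟨h, rfl⟩, rfl⟩
    rw [closure_time]
    intro h'
    exact h (by simp [closure, h'])
  · intro h
    obtain ⟨q, hq⟩ := Option.ne_none_iff_exists'.1 h
    have ht := lift_coe (Ioo_subset_Ico_self (S.mem_Ioo_of_upper hq).1)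
    refine ⟨(i, (t : UnitAddCircle)), ⟨?_, rfl⟩, by rw [closure_time]; exact ht⟩
    simp only [closure, ht, ne_eq, Option.map_eq_none_iff]
    exact h

/-- The number of classical under-crossings on a strand before a given point. -/
def underCount (p : Fin n × ℝ) : ℕ := ((S.closure.underTimes p.1).filter (· < p.2)).card

theorem closure_arcOf {q : Fin n × ℝ} (hq : q.2 ∈ Ioo (0 : ℝ) 1) :
    S.closure.arcOf (q.1, (q.2 : UnitAddCircle)) = (q.1, S.underCount q) := by
  rw [BasedLinkDiagram.arcOf, closure_time, lift_coe (Ioo_subset_Ico_self hq), underCount]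

/-- The entry of `underWord` at an under-crossing. -/
def underEntry (i : Fin n) (t : ℝ) : Option ((Fin n × ℕ) × ℤˣ) :=
  (S.upper (i, lift (t : UnitAddCircle))).map fun q =>
    (S.closure.arcOf (q.1, (q.2 : UnitAddCircle)), S.crossingSign (i, lift (t : UnitAddCircle)))

theorem underWord_eq (i : Fin n) : S.closure.underWord i =
    ((S.closure.underTimes i).sort (· ≤ ·)).filterMap (S.underEntry i) := by
  simp only [BasedLinkDiagram.underWord, bind_pure_comp, List.map_eq_map, List.filterMap_map]
  congr 1
  funext t
  simp [underEntry, closure, Function.comp_def]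

theorem underEntry_of_upper {i : Fin n} {t : ℝ} {q : Fin n × ℝ} (h : S.upper (i, t) = some q) :
    S.underEntry i t = some ((q.1, S.underCount q), S.crossingSign (i, t)) := by
  rw [underEntry, lift_coe (Ioo_subset_Ico_self (S.mem_Ioo_of_upper h).1), h, Option.map_some,
    S.closure_arcOf (S.mem_Ioo_of_upper h).2]

/-- The sorted list of under-crossing times is cut at `t`: the times in front are exactly those
below `t`, and their number is `underCount`. -/
theorem underWord_getElem? {i : Fin n} {t : ℝ} {q : Fin n × ℝ} (h : S.upper (i, t) = some q) :
    (S.closure.underWord i)[S.underCount (i, t)]? =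
      some ((q.1, S.underCount q), S.crossingSign (i, t)) := by
  classical
  have hmem : t ∈ (S.closure.underTimes i).sort (· ≤ ·) := by
    rw [Finset.mem_sort, mem_underTimes, h]
    simp
  obtain ⟨l₁, l₂, hl⟩ := List.append_of_mem hmem
  have hsorted := (S.closure.underTimes i).sortedLT_sort.pairwise
  rw [hl, List.pairwise_append, List.pairwise_cons] at hsorted
  obtain ⟨-, ⟨h2, -⟩, h3⟩ := hsorted
  have hcount : S.underCount (i, t) = l₁.length := by
    have hs : (S.closure.underTimes i).filter (· < t) = l₁.toFinset := by
      ext s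
      rw [Finset.mem_filter, ← Finset.mem_sort (· ≤ ·), hl, List.mem_append, List.mem_cons,
        List.mem_toFinset]
      constructor
      · rintro ⟨h | rfl | h, hst⟩
        · exact h
        · exact absurd hst (lt_irrefl _)
        · exact absurd hst (h2 s h).not_gt
      · exact fun h => ⟨Or.inl h, h3 s h t (by simp)⟩
    have hnd := (S.closure.underTimes i).sort_nodup (· ≤ ·)
    rw [hl] at hnd
    simp only [underCount]
    rw [hs, List.toFinset_card_of_nodup hnd.of_append_left]
  -- Each listed time is a genuine under-crossing, so `filterMap` drops nothing and positions are
  -- preserved.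
  have hlen : ∀ l : List ℝ, (∀ s ∈ l, s ∈ (S.closure.underTimes i).sort (· ≤ ·)) →
      (l.filterMap (S.underEntry i)).length = l.length := by
    intro l
    induction l with
    | nil => simp
    | cons s l ih =>
      intro hs
      obtain ⟨r, hr⟩ := Option.ne_none_iff_exists'.1
        (S.mem_underTimes.1 ((Finset.mem_sort _).1 (hs s (by simp))))
      rw [List.filterMap_cons_some (S.underEntry_of_upper hr), List.length_cons,
        List.length_cons, ih fun s' h' => hs s' (by simp [h'])]
  have hl₁ := hlen l₁ fun s hs => by rw [hl]; simp [hs]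
  rw [underWord_eq, hl, List.filterMap_append,
    List.filterMap_cons_some (S.underEntry_of_upper h), hcount, List.getElem?_append_right hl₁.le, hl₁]
  simp

theorem underWord_length_le (i : Fin n) :
    (S.closure.underWord i).length ≤ S.underCount (i, 1) := by
  have h : (S.closure.underTimes i).filter (· < 1) = S.closure.underTimes i := by
    refine Finset.filter_true_of_mem fun t ht => ?_
    obtain ⟨q, hq⟩ := Option.ne_none_iff_exists'.1 (S.mem_underTimes.1 ht)
    exact (S.mem_Ioo_of_upper hq).1.2
  simp only [underCount]
  rw [h, underWord_eq]
  exact (List.length_filterMap_le _ _).trans (by simp)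

theorem underCount_zero (i : Fin n) : S.underCount (i, 0) = 0 := by
  rw [underCount, Finset.card_eq_zero, Finset.filter_eq_empty_iff]
  intro t ht
  obtain ⟨q, hq⟩ := Option.ne_none_iff_exists'.1 (S.mem_underTimes.1 ht)
  exact (S.mem_Ioo_of_upper hq).1.1.not_gt

/-- There are finitely many under-crossings, so none lies just behind `t`. The count uses a strict
inequality, so a crossing at `t` is counted only after `t`. -/
theorem underCount_right (i : Fin n) (t : ℝ) : ∀ᶠ s in 𝓝[>] t,
    S.underCount (i, s) = S.underCount (i, t) + if S.upper (i, t) = none then 0 else 1 := by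
  classical
  have h : ∀ᶠ s in 𝓝[>] t, ∀ u ∈ S.closure.underTimes i, u < s → u ≤ t := by
    rw [Finset.eventually_all]
    intro u _
    rcases le_or_gt u t with hu | hu
    · exact Eventually.of_forall fun _ _ => hu
    · filter_upwards [Ioo_mem_nhdsGT hu] with s hs h
      exact absurd h hs.2.not_gt
  filter_upwards [h, self_mem_nhdsWithin] with s hs hts
  simp only [underCount]
  by_cases ht : S.upper (i, t) = none
  · rw [if_pos ht, add_zero]
    congr 1
    refine Finset.filter_congr fun u hu => ⟨fun h' => ?_, fun h' => h'.trans hts⟩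
    exact lt_of_le_of_ne (hs u hu h') fun e => S.mem_underTimes.1 hu (e ▸ ht)
  · have e : (S.closure.underTimes i).filter (· < s) =
        insert t ((S.closure.underTimes i).filter (· < t)) := by
      ext u
      simp only [Finset.mem_filter, Finset.mem_insert]
      constructor
      · rintro ⟨hu, h'⟩
        exact (hs u hu h').eq_or_lt.imp id fun h => ⟨hu, h⟩
      · rintro (rfl | ⟨hu, h'⟩)
        · exact ⟨S.mem_underTimes.2 ht, hts⟩
        · exact ⟨hu, h'.trans hts⟩
    rw [if_neg ht, e, Finset.card_insert_of_notMem (by simp)]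

theorem underCount_left (i : Fin n) (t : ℝ) : ∀ᶠ s in 𝓝[<] t,
    S.underCount (i, s) = S.underCount (i, t) := by
  have h : ∀ᶠ s in 𝓝[<] t, ∀ u ∈ S.closure.underTimes i, u < t → u < s := by
    rw [Finset.eventually_all]
    intro u _
    rcases le_or_gt t u with hu | hu
    · exact Eventually.of_forall fun _ h => absurd h hu.not_gt
    · filter_upwards [Ioo_mem_nhdsLT hu] with s hs _
      exact hs.1
  filter_upwards [h, self_mem_nhdsWithin] with s hs hts
  simp only [underCount]
  congr 1
  exact Finset.filter_congr fun u hu => ⟨fun h' => h'.trans hts, hs u hu⟩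

/-- The colour of a point in terms of a longitude function `ν`. -/
def colour (ν : Fin n × ℝ → (NCSeries n)ˣ) (p : Fin n × ℝ) : (NCSeries n)ˣ :=
  (ν p)⁻¹ * unitOneAddX p.1 * ν p

/-- How the value `g` of a longitude function `ν` changes at the point `p`. -/
def step (ν : Fin n × ℝ → (NCSeries n)ˣ) (p : Fin n × ℝ) (g : (NCSeries n)ˣ) : (NCSeries n)ˣ :=
  match S.upper p with
  | none => g
  | some q => unitOneAddX p.1 ^ (-(if q.1 = p.1 then (S.crossingSign p : ℤ) else 0)) * g *
      colour ν q ^ (S.crossingSign p : ℤ)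

/-- `ν` is the function that reads off the over-passing colours along the strands, with the
self-crossings compensated for. -/
structure IsLongitude (ν : Fin n × ℝ → (NCSeries n)ˣ) : Prop where
  start : ∀ i, ν (i, 0) = 1
  right : ∀ i, ∀ t ∈ Ico (0 : ℝ) 1, ∀ᶠ s in 𝓝[>] t, ν (i, s) = S.step ν (i, t) (ν (i, t))
  left : ∀ i, ∀ t ∈ Ioc (0 : ℝ) 1, ∀ᶠ s in 𝓝[<] t, ν (i, s) = ν (i, t)

/-- The longitude function of a diagram. -/
def longitude (p : Fin n × ℝ) : (NCSeries n)ˣ :=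
  S.closure.normalizedLongitude p.1 (S.underCount p)

theorem isLongitude_longitude : S.IsLongitude S.longitude where
  start := fun i => by
    simp only [longitude, underCount_zero, BasedLinkDiagram.normalizedLongitude_zero]
  right := fun i t _ => by
    filter_upwards [S.underCount_right i t] with s hs
    cases h : S.upper (i, t) with
    | none => simp [longitude, step, hs, h]
    | some q =>
      simp only [longitude, step, colour, hs, h, reduceCtorEq, if_false,
        S.closure.normalizedLongitude_succ (S.underWord_getElem? h)]
  left := fun i t _ => by
    filter_upwards [S.underCount_left i t] with s hs
    simp only [longitude, hs]

theorem milnorAt_eq {q : ℕ} {J : List (Fin n)} (h : J.length < q) (i : Fin n) :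
    S.milnorAt q J i = (S.longitude (i, 1) : NCSeries n) J := by
  rw [milnorAt, S.closure.milnorAt_eq h,
    S.closure.etaLimit_preferredLongitude (S.underWord_length_le i)]
  rfl

end StringLinkDiagram

/-- Induction along a closed interval. -/
theorem Icc_induction {a b : ℝ} {P : ℝ → Prop} (ha : P a)
    (hr : ∀ t ∈ Ico a b, P t → ∀ᶠ s in 𝓝[>] t, P s)
    (hl : ∀ t ∈ Ioc a b, (∀ s ∈ Ico a t, P s) → P t) : ∀ t ∈ Icc a b, P t := by
  by_contra! hbad
  -- At the infimum of the failures `P` holds, by `ha` or `hl`, and then `hr` extends it to the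
  -- right, past the infimum.
  set B : Set ℝ := {t | t ∈ Icc a b ∧ ¬P t} with hB
  have hne : B.Nonempty := hbad
  have hbd : BddBelow B := ⟨a, fun t ht => ht.1.1⟩
  have hc : sInf B ∈ Icc a b :=
    ⟨le_csInf hne fun t ht => ht.1.1, (csInf_le hbd hne.some_mem).trans hne.some_mem.1.2⟩
  have hlt : ∀ s ∈ Ico a (sInf B), P s := fun s hs => by
    by_contra h
    exact (csInf_le hbd (⟨⟨hs.1, hs.2.le.trans hc.2⟩, h⟩ : s ∈ B)).not_gt hs.2
  have hPc : P (sInf B) := by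
    rcases hc.1.eq_or_lt with h | h
    · rwa [← h]
    · exact hl _ ⟨h, hc.2⟩ hlt
  have hcb : sInf B < b := by
    refine lt_of_le_of_ne hc.2 fun h => ?_
    obtain ⟨t, ht⟩ := hne
    have : t = sInf B := le_antisymm (ht.1.2.trans h.ge) (csInf_le hbd ht)
    exact ht.2 (this ▸ hPc)
  obtain ⟨u, hu, hPu⟩ := mem_nhdsGT_iff_exists_Ioo_subset.1 (hr _ ⟨hc.1, hcb⟩ hPc)
  obtain ⟨t, ht, htu⟩ := exists_lt_of_csInf_lt hne hu
  rcases (csInf_le hbd ht).eq_or_lt with h | h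
  · exact ht.2 (h ▸ hPc)
  · exact ht.2 (hPu ⟨h, htu⟩)

/-! ### Comparing longitude functions of diagrams that differ in a disk -/

namespace StringLinkDiagram

variable {n : ℕ} {x : EndPoints n} {S S' : StringLinkDiagram x}
  {ν ν' : Fin n × ℝ → (NCSeries n)ˣ}

theorem step_of_upper_eq_none {p : Fin n × ℝ} (h : S.upper p = none) (g : (NCSeries n)ˣ) :
    S.step ν p g = g := by
  simp [step, h]

theorem step_of_upper_eq_some {p q : Fin n × ℝ} (h : S.upper p = some q) (g : (NCSeries n)ˣ) :
    S.step ν p g = unitOneAddX p.1 ^ (-(if q.1 = p.1 then (S.crossingSign p : ℤ) else 0)) * g *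
      colour ν q ^ (S.crossingSign p : ℤ) := by
  simp [step, h]

theorem IsLongitude.eq_step (hν : S.IsLongitude ν) {i : Fin n} {a b : ℝ} (ha : 0 ≤ a) (hab : a < b)
    (hb : b ≤ 1) (h : ∀ t ∈ Ioo a b, S.upper (i, t) = none) :
    ν (i, b) = S.step ν (i, a) (ν (i, a)) := by
  -- The point `a` is exceptional: by left continuity the value there is the one before the jump.
  have key : ∀ t ∈ Icc a b, t = a ∨ ν (i, t) = S.step ν (i, a) (ν (i, a)) := by
    refine Icc_induction (Or.inl rfl) ?_ ?_
    · intro t ht hP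
      rcases ht.1.eq_or_lt with rfl | hat
      · exact (hν.right i a ⟨ha, hab.trans_le hb⟩).mono fun s hs => Or.inr hs
      · filter_upwards [hν.right i t ⟨ha.trans ht.1, ht.2.trans_le hb⟩] with s hs
        rw [step_of_upper_eq_none (h t ⟨hat, ht.2⟩)] at hs
        exact Or.inr (hs.trans (hP.resolve_left hat.ne'))
    · intro t ht hP
      obtain ⟨s, hs, hs'⟩ := ((hν.left i t ⟨ha.trans_lt ht.1, ht.2.trans hb⟩).and
        (Ioo_mem_nhdsLT ht.1)).exists
      exact Or.inr (hs ▸ (hP s ⟨hs'.1.le, hs'.2⟩).resolve_left hs'.1.ne')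
  exact (key b ⟨hab.le, le_rfl⟩).resolve_left hab.ne'

theorem IsLongitude.eq_of_no_under (hν : S.IsLongitude ν) {i : Fin n} {a b : ℝ} (ha : 0 ≤ a)
    (hab : a ≤ b) (hb : b ≤ 1) (h : ∀ t ∈ Ico a b, S.upper (i, t) = none) :
    ν (i, b) = ν (i, a) := by
  rcases hab.eq_or_lt with rfl | hab
  · rfl
  · rw [hν.eq_step ha hab hb fun t ht => h t ⟨ht.1.le, ht.2⟩,
      step_of_upper_eq_none (h a ⟨le_rfl, hab⟩)]

theorem truncate_succ_colour {j : ℕ} {p : Fin n × ℝ} (h : truncate j (ν p) = truncate j (ν' p)) :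
    truncate (j + 1) (colour ν p) = truncate (j + 1) (colour ν' p) :=
  truncate_succ_conj h _

theorem _root_.WeldedMilnor.Arcs.eventually_notMem_closedArc {m : ℕ} {A : Arcs n m} {p : Fin n × ℝ}
    (h : ∀ k, p ∉ A.closedArc k) : ∀ᶠ s in 𝓝 p.2, ∀ k, (p.1, s) ∉ A.closedArc k := by
  rw [eventually_all]
  intro k
  by_cases hk : p.1 = A.comp k
  · have : p.2 ∈ (Icc (A.a k) (A.b k))ᶜ := fun h' => h k ⟨hk, h'⟩
    filter_upwards [isClosed_Icc.isOpen_compl.mem_nhds this] with s hs h'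
    exact hs h'.2
  · exact Eventually.of_forall fun _ h' => hk h'.1

/-- The closed arcs are finitely many closed sets, so the strands coincide in a whole neighbourhood
of `p` in the unit interval. -/
theorem DifferInDisk.velocity_eq {m : ℕ} {δ : Set (ℝ × ℝ)} {A : Arcs n m}
    (hD : S.DifferInDisk S' δ A) {p : Fin n × ℝ} (hp : p.2 ∈ Icc (0 : ℝ) 1)
    (h : ∀ k, p ∉ A.closedArc k) : velocity S.curve p = velocity S'.curve p := by
  have hoff := hD.2.2.2.2.2.2
  refine Filter.EventuallyEq.derivWithin_eq ?_ (hoff p hp h).1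
  filter_upwards [self_mem_nhdsWithin,
    mem_nhdsWithin_of_mem_nhds (Arcs.eventually_notMem_closedArc h)] with s hs hs'
  exact (hoff (p.1, s) hs hs').1

/-- Both strands of a crossing pass through the same point of the plane, and the arcs are exactly
the part of the diagram in the disk. -/
theorem DifferInDisk.notMem_of_upper {m : ℕ} {δ : Set (ℝ × ℝ)} {A : Arcs n m}
    (hD : S.DifferInDisk S' δ A) {p q : Fin n × ℝ} (hpq : S.upper p = some q)
    (h : ∀ k, p ∉ A.closedArc k) : ∀ k, q ∉ A.closedArc k := by
  intro k hk
  obtain ⟨hp, hq, -, he⟩ := S.upper_double _ _ hpq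
  have hδ := (hD.2.2.2.2.1 q hq).1.2 ⟨k, hk⟩
  rw [point, ← he] at hδ
  obtain ⟨l, hl⟩ := (hD.2.2.2.2.1 p hp).1.1 hδ
  exact h l hl

theorem DifferInDisk.crossingSign_eq {m : ℕ} {δ : Set (ℝ × ℝ)} {A : Arcs n m}
    (hD : S.DifferInDisk S' δ A) {p q : Fin n × ℝ} (hpq : S.upper p = some q)
    (h : ∀ k, p ∉ A.closedArc k) : S.crossingSign p = S'.crossingSign p := by
  obtain ⟨hp, hq, -⟩ := S.upper_double _ _ hpq
  have hpq' : S'.upper p = some q := by rw [← (hD.2.2.2.2.2.2 p hp h).2, hpq]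
  simp only [crossingSign, hpq, hpq', rot]
  rw [hD.velocity_eq hp h, hD.velocity_eq hq (hD.notMem_of_upper hpq h)]

/-- No under-crossing of `S` lies at an end of one of the arcs `A`. -/
def UnderInside {m : ℕ} (S : StringLinkDiagram x) (A : Arcs n m) : Prop :=
  ∀ p, S.upper p ≠ none → ∀ k, p ∈ A.closedArc k → p ∈ A.openArc k

/-- The value of `ν` at the end of each of the arcs `A`, in terms of the values at the beginnings of
the arcs. -/
def Transit {m : ℕ} (A : Arcs n m) (e : Fin m → ℤ) (W : Fin m → FreeGroup (Fin m))
    (ν : Fin n × ℝ → (NCSeries n)ˣ) : Prop :=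
  ∀ l, ν (A.comp l, A.b l) = unitOneAddX (A.comp l) ^ e l * ν (A.comp l, A.a l) *
    FreeGroup.lift (fun k => colour ν (A.comp k, A.a k)) (W l)

/-- Longitude functions of diagrams that differ in a disk agree outside of it if they change
in the same way along the arcs in the disk. -/
theorem DifferInDisk.longitude_eq {m : ℕ} {δ : Set (ℝ × ℝ)} {A : Arcs n m}
    (hD : S.DifferInDisk S' δ A) (hν : S.IsLongitude ν) (hν' : S'.IsLongitude ν')
    (hA : S.UnderInside A) (hA' : S'.UnderInside A) {e : Fin m → ℤ}
    {W : Fin m → FreeGroup (Fin m)} (hT : Transit A e W ν) (hT' : Transit A e W ν') (i : Fin n) :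
    ν (i, 1) = ν' (i, 1) := by
  obtain ⟨-, -, hab, hdisj, -, -, hoff⟩ := id hD
  have hcl : ∀ k l p, p ∈ A.closedArc k → p ∈ A.closedArc l → k = l := fun k l p hk hl => by
    by_contra hkl
    exact Set.disjoint_left.1 (hdisj k l hkl) hk hl
  have hsub : ∀ k p, p ∈ A.openArc k → p ∈ A.closedArc k := fun k p hp =>
    ⟨hp.1, Ioo_subset_Icc_self hp.2⟩
  have ha : ∀ k l, (A.comp k, A.a k) ∉ A.openArc l := fun k l h => by
    obtain rfl := hcl k l _ ⟨rfl, le_rfl, (hab k).2.1.le⟩ (hsub l _ h)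
    exact lt_irrefl _ h.2.1
  -- Induction on the degree, then along the strand. Interior points of the arcs are left out, since
  -- inside the disk the two diagrams have no pointwise correspondence.
  have key : ∀ j, ∀ p : Fin n × ℝ, p.2 ∈ Icc (0 : ℝ) 1 → (∀ k, p ∉ A.openArc k) →
      truncate j (ν p) = truncate j (ν' p) := by
    intro j
    induction j with
    | zero => exact fun p _ _ => truncate_zero _ _
    | succ j ih =>
      rintro ⟨i, t⟩ ht
      refine Icc_induction (P := fun t => (∀ k, (i, t) ∉ A.openArc k) →
        truncate (j + 1) (ν (i, t)) = truncate (j + 1) (ν' (i, t))) ?_ ?_ ?_ t ht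
      · intro _
        rw [hν.start, hν'.start]
      · intro t ht hP
        -- On such an arc all points just behind `t` are interior to it, so nothing is claimed about
        -- them.
        by_cases hk : ∃ k, i = A.comp k ∧ t ∈ Ico (A.a k) (A.b k)
        · obtain ⟨k, hk, hk'⟩ := hk
          filter_upwards [Ioo_mem_nhdsGT hk'.2] with s hs h
          exact absurd ⟨hk, hk'.1.trans_lt hs.1, hs.2⟩ (h k)
        · have hopen : ∀ k, (i, t) ∉ A.openArc k := fun k h => hk ⟨k, h.1, h.2.1.le, h.2.2⟩
          filter_upwards [hν.right i t ht, hν'.right i t ht] with s hs hs' _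
          rw [hs, hs']
          -- In the first case `t` is the final point of an arc, where `UnderInside` excludes
          -- under-crossings.
          by_cases hc : ∃ k, (i, t) ∈ A.closedArc k
          · obtain ⟨k, hc⟩ := hc
            rw [step_of_upper_eq_none (by_contra fun h => hopen k (hA _ h k hc)),
              step_of_upper_eq_none (by_contra fun h => hopen k (hA' _ h k hc)), hP hopen]
          · push Not at hc
            have hu := (hoff (i, t) (Ico_subset_Icc_self ht) hc).2
            cases hq : S.upper (i, t) with
            | none =>
              rw [step_of_upper_eq_none hq, step_of_upper_eq_none (hu ▸ hq), hP hopen]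
            | some q =>
              -- The over-crossing point may lie anywhere outside the disk; the hypothesis in degree
              -- `j` suffices, as the colour gains one degree.
              have hcol : truncate (j + 1) (colour ν q) = truncate (j + 1) (colour ν' q) :=
                truncate_succ_colour (ih q (S.upper_double _ _ hq).2.1 fun k h =>
                  hD.notMem_of_upper hq hc k (hsub k _ h))
              rw [step_of_upper_eq_some hq, step_of_upper_eq_some (hu ▸ hq),
                ← hD.crossingSign_eq hq hc]
              simp only [map_mul, map_zpow, hP hopen, hcol]
      · intro t ht hP hopen
        -- At the end of an arc the disk is crossed in one leap, using the common transit formula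
        -- and the values at the beginnings of the arcs.
        by_cases hk : ∃ k, i = A.comp k ∧ t = A.b k
        · obtain ⟨k, rfl, rfl⟩ := hk
          have hlift : (truncate (j + 1)).comp
                (FreeGroup.lift fun k => colour ν (A.comp k, A.a k)) =
              (truncate (j + 1)).comp (FreeGroup.lift fun k => colour ν' (A.comp k, A.a k)) := by
            ext l
            simp only [MonoidHom.comp_apply, FreeGroup.lift_apply_of]
            exact truncate_succ_colour (ih _ ⟨(hab l).1.le, ((hab l).2.1.trans (hab l).2.2).le⟩
              (ha l))
          have hW := DFunLike.congr_fun hlift (W k)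
          simp only [MonoidHom.comp_apply] at hW
          rw [hT, hT']
          simp only [map_mul, hW, hP (A.a k) ⟨(hab k).1.le, (hab k).2.1⟩ (ha k)]
        · have hnear : ∀ᶠ s in 𝓝[<] t, ∀ k, (i, s) ∉ A.openArc k := by
            rw [eventually_all]
            intro k
            by_cases hik : i = A.comp k
            · rcases le_or_gt t (A.a k) with h | h
              · filter_upwards [self_mem_nhdsWithin] with s hs h'
                exact (h'.2.1.trans hs).not_ge h
              · have hb : A.b k < t := by
                  refine lt_of_le_of_ne (not_lt.1 fun h' => hopen k ⟨hik, h, h'⟩) fun h' => ?_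
                  exact hk ⟨k, hik, h'.symm⟩
                filter_upwards [Ioo_mem_nhdsLT hb] with s hs h'
                exact h'.2.2.not_gt hs.1
            · exact Eventually.of_forall fun s h' => hik h'.1
          obtain ⟨s, ⟨⟨hs, hs'⟩, hso⟩, hst⟩ := (((hν.left i t ht).and (hν'.left i t ht)).and
            hnear).and (Ioo_mem_nhdsLT ht.1) |>.exists
          rw [← hs, ← hs']
          exact hP s ⟨hst.1.le, hst.2⟩ hso
  refine eq_of_truncate_eq fun j => key j (i, 1) ⟨zero_le_one, le_rfl⟩ fun k h => ?_
  exact (h.2.2.trans (hab k).2.2).false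

end StringLinkDiagram

namespace StringLinkDiagram

variable {n : ℕ} {x : EndPoints n} {S S' T : StringLinkDiagram x}
  {ν ν' : Fin n × ℝ → (NCSeries n)ˣ}

/-! ### The welded Reidemeister moves -/

theorem IsLongitude.eq_step_of_one_under (hν : S.IsLongitude ν) {i : Fin n} {a u b : ℝ} (ha : 0 ≤ a)
    (hau : a ≤ u) (hub : u < b) (hb : b ≤ 1)
    (h : ∀ t ∈ Ico a b, S.upper (i, t) ≠ none → t = u) :
    ν (i, b) = S.step ν (i, u) (ν (i, a)) := by
  have h' : ∀ t ∈ Ico a b, t ≠ u → S.upper (i, t) = none := fun t ht hne =>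
    by_contra fun hn => hne (h t ht hn)
  rw [hν.eq_step (ha.trans hau) hub hb fun t ht => h' t ⟨hau.trans ht.1.le, ht.2⟩ ht.1.ne',
    hν.eq_of_no_under ha hau (hub.le.trans hb) fun t ht => h' t ⟨ht.1, ht.2.trans hub⟩ ht.2.ne]

theorem IsLongitude.eq_step_of_two_under (hν : S.IsLongitude ν) {i : Fin n} {a u v b : ℝ}
    (ha : 0 ≤ a) (hau : a ≤ u) (huv : u < v) (hvb : v < b) (hb : b ≤ 1)
    (h : ∀ t ∈ Ico a b, S.upper (i, t) ≠ none → t = u ∨ t = v) :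
    ν (i, b) = S.step ν (i, v) (S.step ν (i, u) (ν (i, a))) := by
  rw [hν.eq_step_of_one_under (ha.trans (hau.trans huv.le)) le_rfl hvb hb fun t ht hn =>
      (h t ⟨hau.trans (huv.le.trans ht.1), ht.2⟩ hn).resolve_left (huv.trans_le ht.1).ne',
    hν.eq_step_of_one_under ha hau huv (hvb.le.trans hb) fun t ht hn =>
      (h t ⟨ht.1, ht.2.trans hvb⟩ hn).resolve_right ht.2.ne]

theorem crossingSign_of_upper {p q : Fin n × ℝ} (h : S.upper p = some q) :
    S.crossingSign p = S.rot q p := by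
  simp [crossingSign, h]

/-- `cross` is antisymmetric; transversality excludes the value `0`, for which both senses would be
`-1`. -/
theorem rot_swap {p q : Fin n × ℝ} (h : IsDouble S.curve p q) : S.rot q p = -S.rot p q := by
  have hne := S.transverse p q h
  have hs : cross (velocity S.curve q) (velocity S.curve p) =
      -cross (velocity S.curve p) (velocity S.curve q) := by
    simp only [cross]; ring
  simp only [rot, hs]
  rcases hne.lt_or_gt with h | h
  · rw [if_pos (by linarith), if_neg (by linarith), neg_neg]
  · rw [if_neg (by linarith), if_pos h]

theorem conj_inv_zpow {G : Type*} [Group G] (g y : G) (k : ℤ) :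
    (g⁻¹ * y * g) ^ k = g⁻¹ * y ^ k * g := by
  simpa using conj_zpow (i := k) (a := g⁻¹) (b := y)

theorem colour_eq_of_eq {i : Fin n} {s t : ℝ} (h : ν (i, s) = ν (i, t)) :
    colour ν (i, s) = colour ν (i, t) := by
  simp only [colour, h]

theorem colour_eq_conj {i : Fin n} {s t : ℝ} {k : ℤ} {g : (NCSeries n)ˣ}
    (h : ν (i, s) = unitOneAddX i ^ k * ν (i, t) * g) :
    colour ν (i, s) = g⁻¹ * colour ν (i, t) * g := by
  simp only [colour, h]
  group

theorem mem_doublesOn {m : ℕ} {A : Arcs n m} {p q : Fin n × ℝ} {k : Fin m}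
    (h : S.upper p = some q) (hp : p ∈ A.closedArc k) : (p, q) ∈ S.doublesOn A :=
  ⟨S.upper_double _ _ h, k, hp⟩

theorem mem_closedArc_of_Ico {m : ℕ} {A : Arcs n m} {k : Fin m} {t : ℝ}
    (ht : t ∈ Ico (A.a k) (A.b k)) : (A.comp k, t) ∈ A.closedArc k :=
  ⟨rfl, Ico_subset_Icc_self ht⟩

theorem _root_.WeldedMilnor.Arcs.openArc_subset {m : ℕ} (A : Arcs n m) (k : Fin m) :
    A.openArc k ⊆ A.closedArc k := fun _ hp => ⟨hp.1, Ioo_subset_Icc_self hp.2⟩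

theorem eq_of_mem_closedArc {m : ℕ} {A : Arcs n m}
    (hA : ∀ k l, k ≠ l → Disjoint (A.closedArc k) (A.closedArc l)) {k l : Fin m} {p : Fin n × ℝ}
    (hk : p ∈ A.closedArc k) (hl : p ∈ A.closedArc l) : k = l := by
  by_contra hkl
  exact Set.disjoint_left.1 (hA k l hkl) hk hl

theorem underInside_of_doublesOn {m : ℕ} {A : Arcs n m}
    (hA : ∀ k l, k ≠ l → Disjoint (A.closedArc k) (A.closedArc l))
    (h : ∀ z ∈ S.doublesOn A, ∃ l, z.1 ∈ A.openArc l) : S.UnderInside A := by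
  intro p hp k hk
  obtain ⟨q, hq⟩ := Option.ne_none_iff_exists'.1 hp
  obtain ⟨l, hl⟩ := h _ (mem_doublesOn hq hk)
  obtain rfl := eq_of_mem_closedArc hA hk (A.openArc_subset l hl)
  exact hl

theorem transit_of_eq {m : ℕ} {A : Arcs n m}
    (h : ∀ l, ν (A.comp l, A.b l) = ν (A.comp l, A.a l)) : Transit A 0 1 ν := fun l => by
  simp [h]

/-- The arcs lie in the interior of the unit interval and are not degenerate. -/
def Proper {m : ℕ} (A : Arcs n m) : Prop := ∀ k, 0 < A.a k ∧ A.a k < A.b k ∧ A.b k < 1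

theorem IsLongitude.eq_of_no_under_on (hν : S.IsLongitude ν) {m : ℕ} {A : Arcs n m} (hA : Proper A)
    {k : Fin m} (h : ∀ p ∈ A.closedArc k, S.upper p = none) {t : ℝ}
    (ht : t ∈ Icc (A.a k) (A.b k)) : ν (A.comp k, t) = ν (A.comp k, A.a k) :=
  hν.eq_of_no_under (hA k).1.le ht.1 (ht.2.trans (hA k).2.2.le) fun _ hs =>
    h _ ⟨rfl, hs.1, hs.2.le.trans ht.2⟩

theorem IsLongitude.transit_of_no_under (hν : S.IsLongitude ν) {m : ℕ} {A : Arcs n m}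
    (hA : Proper A) (h : ∀ k, ∀ p ∈ A.closedArc k, S.upper p = none) : Transit A 0 1 ν :=
  transit_of_eq fun l => hν.eq_of_no_under_on hA (h l) ⟨(hA l).2.1.le, le_rfl⟩

theorem upper_eq_none_of_doublesOn_eq_empty {m : ℕ} {A : Arcs n m} (h : S.doublesOn A = ∅)
    (k : Fin m) (p : Fin n × ℝ) (hp : p ∈ A.closedArc k) : S.upper p = none := by
  by_contra hn
  obtain ⟨q, hq⟩ := Option.ne_none_iff_exists'.1 hn
  have := mem_doublesOn hq hp
  rw [h] at this
  exact this

/-- In a classical curl the strand passes under itself once, and the writhe correction cancels the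
contribution of that crossing. A virtual curl contributes nothing. -/
theorem CurlMove.longitude_eq {P : StringLinkDiagram x → Fin n × ℝ → Fin n × ℝ → Prop}
    (h : CurlMove P S S') (hP : ∀ p q, P S' p q → S'.Above p q ∨ S'.IsVirtual p q)
    (hν : S.IsLongitude ν) (hν' : S'.IsLongitude ν') (i : Fin n) : ν (i, 1) = ν' (i, 1) := by
  obtain ⟨δ, A, p, q, hD, hS, hp, hq, hS', hpq⟩ := h
  have hA : Proper A := hD.2.2.1
  have hdisj := hD.2.2.2.1
  have hno := upper_eq_none_of_doublesOn_eq_empty hS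
  refine hD.longitude_eq hν hν' (fun p hp k hk => absurd (hno k p hk) hp) ?_
    (hν.transit_of_no_under hA hno) ?_ i
  · refine underInside_of_doublesOn hdisj fun z hz => ⟨0, ?_⟩
    rw [hS'] at hz
    rcases hz with rfl | rfl
    exacts [hp, hq]
  have hund : ∀ r ∈ A.closedArc 0, S'.upper r ≠ none → r = p ∨ r = q := fun r hr hn => by
    obtain ⟨_, hs⟩ := Option.ne_none_iff_exists'.1 hn
    have := mem_doublesOn hs hr
    rw [hS'] at this
    rcases this with h | h
    exacts [Or.inl (congrArg Prod.fst h), Or.inr (congrArg Prod.fst h)]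
  rcases hP p q hpq with hab | ⟨-, hpn, hqn⟩
  · have hab : S'.upper q = some p := hab
    have hpn := S'.upper_upper _ _ hab
    refine transit_of_eq fun l => ?_
    obtain rfl := Subsingleton.elim 0 l
    obtain ⟨pi, u⟩ := p
    obtain ⟨qi, v⟩ := q
    obtain ⟨rfl, hu⟩ := hp
    obtain ⟨rfl, hv⟩ := hq
    simp only at hu hv
    have hone : ∀ t ∈ Ico (A.a 0) (A.b 0), S'.upper (A.comp 0, t) ≠ none → t = v := fun t ht hn => by
      rcases hund _ (mem_closedArc_of_Ico ht) hn with h | h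
      · exact absurd (h ▸ hpn) hn
      · exact congrArg Prod.snd h
    have hstep : ∀ t ∈ Ioc v (A.b 0), ν' (A.comp 0, t) = _ := fun t ht =>
      hν'.eq_step_of_one_under (hA 0).1.le hv.1.le ht.1 (ht.2.trans (hA 0).2.2.le)
        fun s hs hn => hone s ⟨hs.1, hs.2.trans_le ht.2⟩ hn
    have hb := hstep (A.b 0) ⟨hv.2, le_rfl⟩
    have hne : u ≠ v := fun e => (S'.upper_double _ _ hab).2.2.1 (by rw [e])
    rw [step_of_upper_eq_some hab, if_pos rfl, colour, conj_inv_zpow] at hb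
    -- If the over-crossing comes first, its colour is that of the initial value and the factors
    -- cancel directly. Otherwise its colour is that of the final value, and the resulting implicit
    -- equation has to be solved.
    rcases hne.lt_or_gt with huv | huv
    · have hp0 : ν' (A.comp 0, u) = ν' (A.comp 0, A.a 0) :=
        hν'.eq_of_no_under (hA 0).1.le hu.1.le (hu.2.le.trans (hA 0).2.2.le) fun t ht =>
          by_contra fun hn => (ht.2.trans huv).ne (hone t ⟨ht.1, ht.2.trans hu.2⟩ hn)
      rw [hb, hp0]
      group
    · have hp0 : ν' (A.comp 0, u) = ν' (A.comp 0, A.b 0) := by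
        rw [hstep u ⟨huv, hu.2.le⟩, hstep (A.b 0) ⟨hv.2, le_rfl⟩]
      rw [hp0] at hb
      generalize ν' (A.comp 0, A.b 0) = y at hb ⊢
      generalize ν' (A.comp 0, A.a 0) = g at hb ⊢
      generalize (S'.crossingSign (A.comp 0, v) : ℤ) = k at hb
      generalize (unitOneAddX (A.comp 0) : (NCSeries n)ˣ) = z at hb
      -- The bracket is the right side of `hb`, that is `y`; replacing it collapses the right side
      -- to `1`, so `g = y`.
      have h1 : g * y⁻¹ = z ^ k * (z ^ (-k) * g * (y⁻¹ * z ^ k * y)) * y⁻¹ * z ^ (-k) := by group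
      rw [← hb, mul_inv_cancel_right, ← zpow_add, add_neg_cancel, zpow_zero] at h1
      exact (mul_inv_eq_one.1 h1).symm
  · exact hν'.transit_of_no_under hA fun k r hr => by
      obtain rfl := Subsingleton.elim 0 k
      by_contra hn
      rcases hund r hr hn with rfl | rfl
      exacts [hn hpn, hn hqn]

/-- The over-arc has a single colour and the two crossings have opposite signs, so both the colour
factors and the writhe corrections cancel, in either order along the lower arc. -/
theorem BigonMove.longitude_eq {P : StringLinkDiagram x → Fin n × ℝ → Fin n × ℝ → Prop}
    (h : BigonMove P S S')
    (hP : (∀ p q, P S' p q → S'.Above p q) ∨ (∀ p q, P S' p q → S'.IsVirtual p q))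
    (hν : S.IsLongitude ν) (hν' : S'.IsLongitude ν') (i : Fin n) : ν (i, 1) = ν' (i, 1) := by
  obtain ⟨δ, A, p₁, p₂, q₁, q₂, hD, hS, hp₁, hp₂, hq₁, hq₂, hne, hS', hrot, hP₁, hP₂⟩ := h
  have hA : Proper A := hD.2.2.1
  have hdisj := hD.2.2.2.1
  have hno := upper_eq_none_of_doublesOn_eq_empty hS
  refine hD.longitude_eq hν hν' (fun p hp k hk => absurd (hno k p hk) hp) ?_
    (hν.transit_of_no_under hA hno) ?_ i
  · refine underInside_of_doublesOn hdisj fun z hz => ?_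
    rw [hS'] at hz
    rcases hz with rfl | rfl | rfl | rfl
    exacts [⟨0, hp₁⟩, ⟨1, hq₁⟩, ⟨0, hp₂⟩, ⟨1, hq₂⟩]
  have hund : ∀ k, ∀ r ∈ A.closedArc k, S'.upper r ≠ none → r = p₁ ∨ r = q₁ ∨ r = p₂ ∨ r = q₂ :=
    fun k r hr hn => by
      obtain ⟨s, hs⟩ := Option.ne_none_iff_exists'.1 hn
      have := mem_doublesOn hs hr
      rw [hS'] at this
      rcases this with h | h | h | h
      exacts [Or.inl (congrArg Prod.fst h), Or.inr (Or.inl (congrArg Prod.fst h)),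
        Or.inr (Or.inr (Or.inl (congrArg Prod.fst h))),
        Or.inr (Or.inr (Or.inr (congrArg Prod.fst h)))]
  rcases hP with hP | hP
  · have hab₁ : S'.upper q₁ = some p₁ := hP _ _ hP₁
    have hab₂ : S'.upper q₂ = some p₂ := hP _ _ hP₂
    have hn₁ := S'.upper_upper _ _ hab₁
    have hn₂ := S'.upper_upper _ _ hab₂
    have hs₁ := crossingSign_of_upper hab₁
    have hs₂ := crossingSign_of_upper hab₂
    have hsign : (S'.crossingSign q₁ : ℤ) = -S'.crossingSign q₂ := by
      rw [hs₁, hs₂, hrot, Units.val_neg]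
    have hqne : q₁ ≠ q₂ := fun e => hne (by simpa [e, hab₂] using hab₁.symm)
    have hzero : ∀ r ∈ A.closedArc 0, S'.upper r = none := fun r hr => by
      by_contra hn
      have hq : ∀ q ∈ A.openArc 1, r ≠ q := fun q hq e =>
        absurd (eq_of_mem_closedArc hdisj (e ▸ hr) (A.openArc_subset 1 hq)) (by decide)
      rcases hund 0 r hr hn with rfl | rfl | rfl | rfl
      exacts [hn hn₁, hq _ hq₁ rfl, hn hn₂, hq _ hq₂ rfl]
    obtain ⟨pi₁, u₁⟩ := p₁
    obtain ⟨qi₁, v₁⟩ := q₁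
    obtain ⟨pi₂, u₂⟩ := p₂
    obtain ⟨qi₂, v₂⟩ := q₂
    obtain ⟨rfl, hu₁⟩ := hp₁
    obtain ⟨rfl, hv₁⟩ := hq₁
    obtain ⟨rfl, hu₂⟩ := hp₂
    obtain ⟨rfl, hv₂⟩ := hq₂
    simp only at hu₁ hv₁ hu₂ hv₂
    have hcol : colour ν' (A.comp 0, u₁) = colour ν' (A.comp 0, u₂) := colour_eq_of_eq <| by
      rw [hν'.eq_of_no_under_on hA hzero (Ioo_subset_Icc_self hu₁),
        hν'.eq_of_no_under_on hA hzero (Ioo_subset_Icc_self hu₂)]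
    have htwo : ∀ t ∈ Ico (A.a 1) (A.b 1), S'.upper (A.comp 1, t) ≠ none → t = v₁ ∨ t = v₂ :=
      fun t ht hn => by
        rcases hund 1 _ (mem_closedArc_of_Ico ht) hn with h | h | h | h
        exacts [absurd (h ▸ hn₁) hn, Or.inl (congrArg Prod.snd h), absurd (h ▸ hn₂) hn,
          Or.inr (congrArg Prod.snd h)]
    refine transit_of_eq fun l => ?_
    fin_cases l
    · exact hν'.eq_of_no_under_on hA hzero ⟨(hA 0).2.1.le, le_rfl⟩
    · change ν' (A.comp 1, A.b 1) = ν' (A.comp 1, A.a 1)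
      have hvne : v₁ ≠ v₂ := fun e => hqne (by rw [e])
      rcases hvne.lt_or_gt with hv | hv
      · rw [hν'.eq_step_of_two_under (hA 1).1.le hv₁.1.le hv hv₂.2 (hA 1).2.2.le htwo,
          step_of_upper_eq_some hab₁, step_of_upper_eq_some hab₂, hcol, hsign]
        split_ifs <;> group
      · rw [hν'.eq_step_of_two_under (hA 1).1.le hv₂.1.le hv hv₁.2 (hA 1).2.2.le
            fun t ht hn => (htwo t ht hn).symm,
          step_of_upper_eq_some hab₁, step_of_upper_eq_some hab₂, hcol, hsign]
        split_ifs <;> group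
  · obtain ⟨-, h1, h2⟩ := hP _ _ hP₁
    obtain ⟨-, h3, h4⟩ := hP _ _ hP₂
    exact hν'.transit_of_no_under hA fun k r hr => by
      by_contra hn
      rcases hund k r hr hn with rfl | rfl | rfl | rfl
      exacts [hn h1, hn h2, hn h3, hn h4]

end StringLinkDiagram

namespace StringLinkDiagram

variable {n : ℕ} {x : EndPoints n} {S S' T : StringLinkDiagram x}
  {ν ν' : Fin n × ℝ → (NCSeries n)ˣ}

/-! ### Triangle moves -/

section Triangle

variable {A : Arcs n 3} {c c' : Fin 3 → Fin 3 → Fin n × ℝ}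

theorem IsTriangle.eq_mk (h : T.IsTriangle A c) {i j : Fin 3} (hij : i ≠ j) :
    (A.comp i, (c i j).2) = c i j := Prod.ext (h.1 i j hij).1.symm rfl

theorem IsTriangle.isDouble (h : T.IsTriangle A c) {i j : Fin 3} (hij : i ≠ j) :
    IsDouble T.curve (c i j) (c j i) := by
  have hz : (c i j, c j i) ∈ T.doublesOn A := by
    rw [h.2.1]
    exact ⟨i, j, hij, rfl⟩
  exact hz.1

theorem IsTriangle.underInside (h : T.IsTriangle A c)
    (hdisj : ∀ k l, k ≠ l → Disjoint (A.closedArc k) (A.closedArc l)) : T.UnderInside A := by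
  refine underInside_of_doublesOn hdisj fun z hz => ?_
  rw [h.2.1] at hz
  obtain ⟨i, j, hij, rfl⟩ := hz
  exact ⟨i, h.1 i j hij⟩

theorem IsTriangle.eq_of_upper (h : T.IsTriangle A c)
    (hdisj : ∀ k l, k ≠ l → Disjoint (A.closedArc k) (A.closedArc l)) {k : Fin 3} {p : Fin n × ℝ}
    (hp : p ∈ A.closedArc k) (hn : T.upper p ≠ none) :
    ∃ j, k ≠ j ∧ p = c k j ∧ T.upper (c k j) ≠ none := by
  obtain ⟨q, hq⟩ := Option.ne_none_iff_exists'.1 hn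
  have hz := mem_doublesOn hq hp
  rw [h.2.1] at hz
  obtain ⟨i, j, hij, he⟩ := hz
  obtain rfl : p = c i j := congrArg Prod.fst he
  obtain rfl := eq_of_mem_closedArc hdisj hp (A.openArc_subset i (h.1 i j hij))
  exact ⟨j, hij, rfl, hn⟩

theorem IsTriangle.upper_eq_none (h : T.IsTriangle A c)
    (hdisj : ∀ k l, k ≠ l → Disjoint (A.closedArc k) (A.closedArc l)) {k : Fin 3}
    (hc : ∀ j, k ≠ j → T.upper (c k j) = none) (p : Fin n × ℝ) (hp : p ∈ A.closedArc k) :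
    T.upper p = none := by
  by_contra hn
  obtain ⟨j, hkj, -, hj⟩ := h.eq_of_upper hdisj hp hn
  exact hj (hc j hkj)

theorem IsTriangle.eq_of_upper_of_one (h : T.IsTriangle A c)
    (hdisj : ∀ k l, k ≠ l → Disjoint (A.closedArc k) (A.closedArc l)) {k l : Fin 3}
    (hc : ∀ j, k ≠ j → j ≠ l → T.upper (c k j) = none) (t : ℝ) (ht : t ∈ Ico (A.a k) (A.b k))
    (hn : T.upper (A.comp k, t) ≠ none) : t = (c k l).2 := by
  obtain ⟨j, hkj, hj, hj'⟩ := h.eq_of_upper hdisj (mem_closedArc_of_Ico ht) hn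
  obtain rfl : j = l := by_contra fun hjl => hj' (hc j hkj hjl)
  exact congrArg Prod.snd hj

/-- If the two crossings coincided, the absence of triple points would identify points on two
disjoint arcs. -/
theorem IsTriangle.ne (h : T.IsTriangle A c)
    (hdisj : ∀ k l, k ≠ l → Disjoint (A.closedArc k) (A.closedArc l)) {i j k : Fin 3}
    (hij : i ≠ j) (hik : i ≠ k) (hjk : j ≠ k) : (c i j).2 ≠ (c i k).2 := by
  intro e
  have e' : c i j = c i k := by rw [← h.eq_mk hij, ← h.eq_mk hik, e]
  have he := T.no_triple _ _ _ (h.isDouble hij) (e' ▸ h.isDouble hik)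
  refine hjk (eq_of_mem_closedArc hdisj (A.openArc_subset j (h.1 j i hij.symm)) ?_)
  rw [he]
  exact A.openArc_subset k (h.1 k i hik.symm)

/-- The value of a longitude function on an arc behind its only under-crossing. -/
theorem IsTriangle.eq_of_one_under (h : T.IsTriangle A c) (hν : T.IsLongitude ν) (hA : Proper A)
    (hdisj : ∀ k l, k ≠ l → Disjoint (A.closedArc k) (A.closedArc l)) {k l : Fin 3} (hkl : k ≠ l)
    (hc : ∀ j, k ≠ j → j ≠ l → T.upper (c k j) = none) (hu : T.upper (c k l) = some (c l k))
    {t : ℝ} (ht : t ∈ Ioc (c k l).2 (A.b k)) :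
    ν (A.comp k, t) = unitOneAddX (A.comp k) ^
        (-(if A.comp l = A.comp k then (T.rot (c l k) (c k l) : ℤ) else 0)) *
      ν (A.comp k, A.a k) * colour ν (A.comp l, (c l k).2) ^ (T.rot (c l k) (c k l) : ℤ) := by
  have hk := h.1 k l hkl
  rw [hν.eq_step_of_one_under (hA k).1.le hk.2.1.le ht.1 (ht.2.trans (hA k).2.2.le)
    fun s hs hn => h.eq_of_upper_of_one hdisj hc s ⟨hs.1, hs.2.trans_le ht.2⟩ hn,
    h.eq_mk hkl, step_of_upper_eq_some hu, crossingSign_of_upper hu, hk.1, (h.1 l k hkl.symm).1,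
    h.eq_mk hkl.symm]

/-- Arc 1 has no under-crossing and hence one colour, so it does not matter where arc 2 passes under
it. -/
theorem IsTriangle.transit_of_mixed (h : T.IsTriangle A c) (hν : T.IsLongitude ν) (hA : Proper A)
    (hdisj : ∀ k l, k ≠ l → Disjoint (A.closedArc k) (A.closedArc l))
    (h₀₁ : T.IsVirtual (c 0 1) (c 1 0)) (h₀₂ : T.IsVirtual (c 0 2) (c 2 0))
    (h₁₂ : T.Above (c 1 2) (c 2 1)) :
    Transit A ![0, 0, -(if A.comp 1 = A.comp 2 then (T.rot (c 1 2) (c 2 1) : ℤ) else 0)]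
      ![1, 1, FreeGroup.of 1 ^ (T.rot (c 1 2) (c 2 1) : ℤ)] ν := by
  have h0 : ∀ p ∈ A.closedArc 0, T.upper p = none := h.upper_eq_none hdisj fun j hj => by
    fin_cases j
    exacts [absurd rfl hj, h₀₁.2.1, h₀₂.2.1]
  have h1 : ∀ p ∈ A.closedArc 1, T.upper p = none := h.upper_eq_none hdisj fun j hj => by
    fin_cases j
    exacts [h₀₁.2.2, absurd rfl hj, T.upper_upper _ _ h₁₂]
  have h2 : ∀ j, (2 : Fin 3) ≠ j → j ≠ 1 → T.upper (c 2 j) = none := fun j hj hj' => by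
    fin_cases j
    exacts [h₀₂.2.2, absurd rfl hj', absurd rfl hj]
  intro l
  fin_cases l
  · simpa using hν.eq_of_no_under_on hA h0 ⟨(hA 0).2.1.le, le_rfl⟩
  · simpa using hν.eq_of_no_under_on hA h1 ⟨(hA 1).2.1.le, le_rfl⟩
  · have := h.eq_of_one_under hν hA hdisj (by decide) h2 h₁₂
      ⟨(h.1 2 1 (by decide)).2.2, le_rfl⟩
    rw [colour_eq_of_eq (hν.eq_of_no_under_on hA h1
      (Ioo_subset_Icc_self (h.1 1 2 (by decide)).2))] at this
    simpa using this

/-- Arcs 1 and 2 each pass once under arc 0, whose colour is constant; the virtual crossing between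
them does not affect the longitudes. -/
theorem IsTriangle.transit_of_over (h : T.IsTriangle A c) (hν : T.IsLongitude ν) (hA : Proper A)
    (hdisj : ∀ k l, k ≠ l → Disjoint (A.closedArc k) (A.closedArc l))
    (h₀₁ : T.Above (c 0 1) (c 1 0)) (h₀₂ : T.Above (c 0 2) (c 2 0))
    (h₁₂ : T.IsVirtual (c 1 2) (c 2 1)) :
    Transit A ![0, -(if A.comp 0 = A.comp 1 then (T.rot (c 0 1) (c 1 0) : ℤ) else 0),
        -(if A.comp 0 = A.comp 2 then (T.rot (c 0 2) (c 2 0) : ℤ) else 0)]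
      ![1, FreeGroup.of 0 ^ (T.rot (c 0 1) (c 1 0) : ℤ),
        FreeGroup.of 0 ^ (T.rot (c 0 2) (c 2 0) : ℤ)] ν := by
  have h0 : ∀ p ∈ A.closedArc 0, T.upper p = none := h.upper_eq_none hdisj fun j hj => by
    fin_cases j
    exacts [absurd rfl hj, T.upper_upper _ _ h₀₁, T.upper_upper _ _ h₀₂]
  have h1 : ∀ j, (1 : Fin 3) ≠ j → j ≠ 0 → T.upper (c 1 j) = none := fun j hj hj' => by
    fin_cases j
    exacts [absurd rfl hj', absurd rfl hj, h₁₂.2.1]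
  have h2 : ∀ j, (2 : Fin 3) ≠ j → j ≠ 0 → T.upper (c 2 j) = none := fun j hj hj' => by
    fin_cases j
    exacts [absurd rfl hj', h₁₂.2.2, absurd rfl hj]
  intro l
  fin_cases l
  · simpa using hν.eq_of_no_under_on hA h0 ⟨(hA 0).2.1.le, le_rfl⟩
  · have := h.eq_of_one_under hν hA hdisj (by decide) h1 h₀₁
      ⟨(h.1 1 0 (by decide)).2.2, le_rfl⟩
    rw [colour_eq_of_eq (hν.eq_of_no_under_on hA h0
      (Ioo_subset_Icc_self (h.1 0 1 (by decide)).2))] at this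
    simpa using this
  · have := h.eq_of_one_under hν hA hdisj (by decide) h2 h₀₂
      ⟨(h.1 2 0 (by decide)).2.2, le_rfl⟩
    rw [colour_eq_of_eq (hν.eq_of_no_under_on hA h0
      (Ioo_subset_Icc_self (h.1 0 2 (by decide)).2))] at this
    simpa using this

/-- Arc 2 meets arcs 0 and 1 in either order, and arc 1 meets it before or after being conjugated by
the colour of arc 0. The orders are tied to the senses of the crossings, so that the product along
arc 2 depends only on the senses, which the move preserves. -/
theorem IsTriangle.transit_of_classical (h : T.IsTriangle A c) (hν : T.IsLongitude ν)
    (hA : Proper A) (hdisj : ∀ k l, k ≠ l → Disjoint (A.closedArc k) (A.closedArc l))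
    (h₀₁ : T.Above (c 0 1) (c 1 0)) (h₀₂ : T.Above (c 0 2) (c 2 0))
    (h₁₂ : T.Above (c 1 2) (c 2 1)) :
    Transit A ![0, -(if A.comp 0 = A.comp 1 then (T.rot (c 0 1) (c 1 0) : ℤ) else 0),
        -(if A.comp 0 = A.comp 2 then (T.rot (c 0 2) (c 2 0) : ℤ) else 0) -
          (if A.comp 1 = A.comp 2 then (T.rot (c 1 2) (c 2 1) : ℤ) else 0)]
      ![1, FreeGroup.of 0 ^ (T.rot (c 0 1) (c 1 0) : ℤ),
        if T.rot (c 0 1) (c 1 0) = T.rot (c 0 2) (c 2 0) then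
          FreeGroup.of 1 ^ (T.rot (c 1 2) (c 2 1) : ℤ) *
            FreeGroup.of 0 ^ (T.rot (c 0 2) (c 2 0) : ℤ)
        else FreeGroup.of 0 ^ (T.rot (c 0 2) (c 2 0) : ℤ) *
            FreeGroup.of 1 ^ (T.rot (c 1 2) (c 2 1) : ℤ)] ν := by
  have h0 : ∀ p ∈ A.closedArc 0, T.upper p = none := h.upper_eq_none hdisj fun j hj => by
    fin_cases j
    exacts [absurd rfl hj, T.upper_upper _ _ h₀₁, T.upper_upper _ _ h₀₂]
  have h1 : ∀ j, (1 : Fin 3) ≠ j → j ≠ 0 → T.upper (c 1 j) = none := fun j hj hj' => by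
    fin_cases j
    exacts [absurd rfl hj', absurd rfl hj, T.upper_upper _ _ h₁₂]
  have h2 : ∀ t ∈ Ico (A.a 2) (A.b 2), T.upper (A.comp 2, t) ≠ none →
      t = (c 2 0).2 ∨ t = (c 2 1).2 := fun t ht hn => by
    obtain ⟨j, hj, hj', -⟩ := h.eq_of_upper hdisj (mem_closedArc_of_Ico ht) hn
    fin_cases j
    exacts [Or.inl (congrArg Prod.snd hj'), Or.inr (congrArg Prod.snd hj'), absurd rfl hj]
  have hcol : ∀ j, (0 : Fin 3) ≠ j →
      colour ν (A.comp 0, (c 0 j).2) = colour ν (A.comp 0, A.a 0) := fun j hj =>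
    colour_eq_of_eq (hν.eq_of_no_under_on hA h0 (Ioo_subset_Icc_self (h.1 0 j hj).2))
  have hone : ∀ t ∈ Ioc (c 1 0).2 (A.b 1), _ := fun t ht =>
    h.eq_of_one_under hν hA hdisj (by decide) h1 h₀₁ ht
  simp only [hcol 1 (by decide)] at hone
  -- The triangle condition for arcs 1 and 2. After `rot_swap` it says that arc 1 meets arc 2 before
  -- arc 0 exactly when arc 2 meets arc 0 before arc 1, if and only if arc 0 crosses them in
  -- opposite senses.
  have hsense : ((c 1 2).2 < (c 1 0).2 ↔ (c 2 0).2 < (c 2 1).2) ↔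
      T.rot (c 2 0) (c 0 2) = T.rot (c 0 1) (c 1 0) := h.2.2 1 2
  rw [rot_swap (h.isDouble (i := 0) (j := 2) (by decide))] at hsense
  have hm10 := (h.1 1 0 (by decide)).2
  have hm12 := (h.1 1 2 (by decide)).2
  have hm20 := (h.1 2 0 (by decide)).2
  have hm21 := (h.1 2 1 (by decide)).2
  have hs20 : ∀ g, T.step ν (A.comp 2, (c 2 0).2) g = unitOneAddX (A.comp 2) ^
        (-(if A.comp 0 = A.comp 2 then (T.rot (c 0 2) (c 2 0) : ℤ) else 0)) * g *
      colour ν (A.comp 0, A.a 0) ^ (T.rot (c 0 2) (c 2 0) : ℤ) := fun g => by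
    rw [h.eq_mk (i := 2) (j := 0) (by decide), step_of_upper_eq_some h₀₂,
      crossingSign_of_upper h₀₂, (h.1 2 0 (by decide)).1, (h.1 0 2 (by decide)).1,
      ← hcol 2 (by decide), h.eq_mk (i := 0) (j := 2) (by decide)]
  have hs21 : ∀ g, T.step ν (A.comp 2, (c 2 1).2) g = unitOneAddX (A.comp 2) ^
        (-(if A.comp 1 = A.comp 2 then (T.rot (c 1 2) (c 2 1) : ℤ) else 0)) * g *
      colour ν (A.comp 1, (c 1 2).2) ^ (T.rot (c 1 2) (c 2 1) : ℤ) := fun g => by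
    rw [h.eq_mk (i := 2) (j := 1) (by decide), step_of_upper_eq_some h₁₂,
      crossingSign_of_upper h₁₂, (h.1 2 1 (by decide)).1, (h.1 1 2 (by decide)).1,
      h.eq_mk (i := 1) (j := 2) (by decide)]
  have hbefore : (c 1 2).2 < (c 1 0).2 →
      colour ν (A.comp 1, (c 1 2).2) = colour ν (A.comp 1, A.a 1) := fun hlt =>
    colour_eq_of_eq <| hν.eq_of_no_under (hA 1).1.le hm12.1.le (hm12.2.trans (hA 1).2.2).le
      fun t ht => by_contra fun hn => (ht.2.trans hlt).ne
        (h.eq_of_upper_of_one hdisj h1 t ⟨ht.1, ht.2.trans hm12.2⟩ hn)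
  have hafter : (c 1 0).2 < (c 1 2).2 → _ := fun hlt =>
    colour_eq_conj (hone (c 1 2).2 ⟨hlt, hm12.2.le⟩)
  intro l
  fin_cases l
  · simpa using hν.eq_of_no_under_on hA h0 ⟨(hA 0).2.1.le, le_rfl⟩
  · simpa using hone _ ⟨hm10.2, le_rfl⟩
  · simp only [Fin.reduceFinMk, Matrix.cons_val]
    have hne1 := h.ne hdisj (i := 1) (j := 2) (k := 0) (by decide) (by decide) (by decide)
    have hne2 := h.ne hdisj (i := 2) (j := 0) (k := 1) (by decide) (by decide) (by decide)
    have hneg : ∀ u : ℤˣ, -u ≠ u := by decide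
    have hflip : ∀ {u v : ℤˣ}, u ≠ v → (u : ℤ) = -(v : ℤ) := by decide
    -- With `x`, `y` the initial colours of arcs 0 and 1, and `s`, `r`, `t` the senses of the pairs
    -- 01, 02, 12, the four products are `x^r y^t`, `x^r (x^(-s) y^t x^s)`, `y^t x^r` and `(x^(-s)
    -- y^t x^s) x^r`. They reduce to `y^t x^r` if `s = r` and to `x^r y^t` if `s = -r`.
    rcases hne2.lt_or_gt with ho2 | ho2
    · rw [hν.eq_step_of_two_under (hA 2).1.le hm20.1.le ho2 hm21.2 (hA 2).2.2.le h2, hs20, hs21]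
      rcases hne1.lt_or_gt with ho1 | ho1
      · have hr : T.rot (c 0 1) (c 1 0) ≠ T.rot (c 0 2) (c 2 0) := by
          have := hsense.1 ⟨fun _ => ho2, fun _ => ho1⟩
          rw [← this]
          exact hneg _
        rw [if_neg hr, hbefore ho1]
        simp only [map_mul, map_zpow, FreeGroup.lift_apply_of]
        group
      · have hr : T.rot (c 0 1) (c 1 0) = T.rot (c 0 2) (c 2 0) := by
          by_contra hr
          have := hsense.2 (by ext; rw [Units.val_neg, hflip hr])
          exact ho1.not_gt (this.2 ho2)
        rw [if_pos hr, hafter ho1, conj_inv_zpow, hr]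
        simp only [map_mul, map_zpow, FreeGroup.lift_apply_of]
        group
    · rw [hν.eq_step_of_two_under (hA 2).1.le hm21.1.le ho2 hm20.2 (hA 2).2.2.le
        (fun t ht hn => (h2 t ht hn).symm), hs20, hs21]
      rcases hne1.lt_or_gt with ho1 | ho1
      · have hr : T.rot (c 0 1) (c 1 0) = T.rot (c 0 2) (c 2 0) := by
          by_contra hr
          have := hsense.2 (by ext; rw [Units.val_neg, hflip hr])
          exact ho2.not_gt (this.1 ho1)
        rw [if_pos hr, hbefore ho1]
        simp only [map_mul, map_zpow, FreeGroup.lift_apply_of]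
        group
      · have hr : T.rot (c 0 1) (c 1 0) ≠ T.rot (c 0 2) (c 2 0) := by
          have := hsense.1 ⟨fun h => absurd h ho1.not_gt, fun h => absurd h ho2.not_gt⟩
          rw [← this]
          exact hneg _
        rw [if_neg hr, hafter ho1, conj_inv_zpow, hflip hr]
        simp only [map_mul, map_zpow, FreeGroup.lift_apply_of]
        group

/-- Longitude functions agree at the end if a triangle move does not change the transits. -/
theorem TriangleMove.longitude_eq
    {P : StringLinkDiagram x → (Fin 3 → Fin 3 → Fin n × ℝ) → Prop} (h : TriangleMove P S S')
    (e : Arcs n 3 → (Fin 3 → Fin 3 → ℤˣ) → Fin 3 → ℤ)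
    (W : (Fin 3 → Fin 3 → ℤˣ) → Fin 3 → FreeGroup (Fin 3))
    (hP : ∀ (T : StringLinkDiagram x) (A : Arcs n 3) c ν, T.IsTriangle A c → T.IsLongitude ν →
      Proper A → (∀ k l, k ≠ l → Disjoint (A.closedArc k) (A.closedArc l)) → P T c →
      ∀ r : Fin 3 → Fin 3 → ℤˣ, (∀ i j, i ≠ j → T.rot (c i j) (c j i) = r i j) →
        Transit A (e A r) (W r) ν)
    (hν : S.IsLongitude ν) (hν' : S'.IsLongitude ν') (i : Fin n) : ν (i, 1) = ν' (i, 1) := by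
  obtain ⟨δ, A, c, c', hD, hT, hT', hrot, -, hPc, hPc'⟩ := h
  exact hD.longitude_eq hν hν' (hT.underInside hD.2.2.2.1) (hT'.underInside hD.2.2.2.1)
    -- The senses in `S` serve for both diagrams, so both transits are given by the same data.
    (hP S A c ν hT hν hD.2.2.1 hD.2.2.2.1 hPc (fun i j => S.rot (c i j) (c j i)) fun _ _ _ => rfl)
    (hP S' A c' ν' hT' hν' hD.2.2.1 hD.2.2.2.1 hPc' (fun i j => S.rot (c i j) (c j i))
      fun i j hij => (hrot i j hij).symm) i

end Triangle

theorem WeldedMove.longitude_eq (h : WeldedMove S S') (hν : S.IsLongitude ν)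
    (hν' : S'.IsLongitude ν') (i : Fin n) : ν (i, 1) = ν' (i, 1) := by
  have h01 : (0 : Fin 3) ≠ 1 := by decide
  have h02 : (0 : Fin 3) ≠ 2 := by decide
  have h12 : (1 : Fin 3) ≠ 2 := by decide
  cases h with
  | R1 h => exact h.longitude_eq (fun _ _ => Or.inl) hν hν' i
  | V1 h => exact h.longitude_eq (fun _ _ => Or.inr) hν hν' i
  | R2 h => exact h.longitude_eq (Or.inl fun _ _ => id) hν hν' i
  | V2 h => exact h.longitude_eq (Or.inr fun _ _ => id) hν hν' i
  | V3 h =>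
    refine h.longitude_eq (fun _ _ => 0) (fun _ => 1) ?_ hν hν' i
    intro T A c ν hT hν hA hdisj hP _ _
    refine hν.transit_of_no_under hA fun k => hT.upper_eq_none hdisj fun j hkj => ?_
    obtain ⟨⟨-, h1, h2⟩, ⟨-, h3, h4⟩, -, h5, h6⟩ := hP
    fin_cases k <;> fin_cases j <;> first | exact absurd rfl hkj | assumption
  | V4 h =>
    refine h.longitude_eq
      (fun A r => ![0, 0, -(if A.comp 1 = A.comp 2 then (r 1 2 : ℤ) else 0)])
      (fun r => ![1, 1, FreeGroup.of 1 ^ (r 1 2 : ℤ)]) ?_ hν hν' i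
    intro T A c ν hT hν hA hdisj hP r hr
    have := hT.transit_of_mixed hν hA hdisj hP.1 hP.2.1 hP.2.2
    rwa [hr 1 2 h12] at this
  | OC h =>
    refine h.longitude_eq
      (fun A r => ![0, -(if A.comp 0 = A.comp 1 then (r 0 1 : ℤ) else 0),
        -(if A.comp 0 = A.comp 2 then (r 0 2 : ℤ) else 0)])
      (fun r => ![1, FreeGroup.of 0 ^ (r 0 1 : ℤ), FreeGroup.of 0 ^ (r 0 2 : ℤ)]) ?_ hν hν' i
    intro T A c ν hT hν hA hdisj hP r hr
    have := hT.transit_of_over hν hA hdisj hP.1 hP.2.1 hP.2.2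
    rwa [hr 0 1 h01, hr 0 2 h02] at this
  | R3 h =>
    refine h.longitude_eq
      (fun A r => ![0, -(if A.comp 0 = A.comp 1 then (r 0 1 : ℤ) else 0),
        -(if A.comp 0 = A.comp 2 then (r 0 2 : ℤ) else 0) -
          (if A.comp 1 = A.comp 2 then (r 1 2 : ℤ) else 0)])
      (fun r => ![1, FreeGroup.of 0 ^ (r 0 1 : ℤ),
        if r 0 1 = r 0 2 then FreeGroup.of 1 ^ (r 1 2 : ℤ) * FreeGroup.of 0 ^ (r 0 2 : ℤ)
        else FreeGroup.of 0 ^ (r 0 2 : ℤ) * FreeGroup.of 1 ^ (r 1 2 : ℤ)]) ?_ hν hν' i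
    intro T A c ν hT hν hA hdisj hP r hr
    have := hT.transit_of_classical hν hA hdisj hP.1 hP.2.1 hP.2.2
    rwa [hr 0 1 h01, hr 0 2 h02, hr 1 2 h12] at this

end StringLinkDiagram

/-! ### Planar isotopies -/

/-- Used with the derivative of the diffeomorphism: a positive determinant preserves the signs of
crossings. -/
theorem cross_map (L : ℝ × ℝ →L[ℝ] ℝ × ℝ) (v w : ℝ × ℝ) :
    cross (L v) (L w) = L.det * cross v w := by
  have hdet : L.det = (L (1, 0)).1 * (L (0, 1)).2 - (L (0, 1)).1 * (L (1, 0)).2 := by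
    rw [ContinuousLinearMap.det, ← LinearMap.det_toMatrix (Module.Basis.finTwoProd ℝ),
      Matrix.det_fin_two]
    simp [LinearMap.toMatrix_apply]
  have hL : ∀ u : ℝ × ℝ, L u = u.1 • L (1, 0) + u.2 • L (0, 1) := fun u => by
    rw [← map_smul, ← map_smul, ← map_add]
    simp
  rw [hL v, hL w, hdet]
  simp only [cross, Prod.fst_add, Prod.snd_add, Prod.smul_fst, Prod.smul_snd, smul_eq_mul]
  ring

theorem cross_smul (a b : ℝ) (v w : ℝ × ℝ) : cross (a • v) (b • w) = a * b * cross v w := by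
  simp only [cross, Prod.smul_fst, Prod.smul_snd, smul_eq_mul]
  ring

theorem isOpen_openSquare : IsOpen openSquare := isOpen_Ioo.prod isOpen_Ioo

namespace StringLinkDiagram

variable {n : ℕ} {x : EndPoints n} {S S' : StringLinkDiagram x}
  {ν ν' : Fin n × ℝ → (NCSeries n)ˣ}

/-- A diagram has only one longitude function. -/
theorem IsLongitude.unique (hν : S.IsLongitude ν) (hν' : S.IsLongitude ν') {p : Fin n × ℝ}
    (hp : p.2 ∈ Icc (0 : ℝ) 1) : ν p = ν' p := by
  refine eq_of_truncate_eq fun j => ?_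
  induction j generalizing p with
  | zero => exact truncate_zero _ _
  | succ j ih =>
    obtain ⟨i, t⟩ := p
    refine Icc_induction (P := fun t => truncate (j + 1) (ν (i, t)) =
      truncate (j + 1) (ν' (i, t))) ?_ ?_ ?_ t hp
    · rw [hν.start, hν'.start]
    · intro t ht hP
      filter_upwards [hν.right i t ht, hν'.right i t ht] with s hs hs'
      rw [hs, hs']
      cases hq : S.upper (i, t) with
      | none => rw [step_of_upper_eq_none hq, step_of_upper_eq_none hq, hP]
      | some q =>
        -- The over-crossing point may come later on the same strand, so only the hypothesis in
        -- degree `j` is available for it; conjugation supplies the missing degree.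
        have hcol : truncate (j + 1) (colour ν q) = truncate (j + 1) (colour ν' q) :=
          truncate_succ_colour (ih (S.upper_double _ _ hq).2.1)
        rw [step_of_upper_eq_some hq, step_of_upper_eq_some hq]
        simp only [map_mul, map_zpow, hP, hcol]
    · intro t ht hP
      obtain ⟨s, ⟨hs, hs'⟩, hst⟩ := (((hν.left i t ht).and (hν'.left i t ht)).and
        (Ioo_mem_nhdsLT ht.1)).exists
      rw [← hs, ← hs']
      exact hP s ⟨hst.1.le, hst.2⟩

/-- The chain rule, at points inside the square, where smoothness of `h` on the closed square yields
a full derivative. -/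
theorem velocity_comp {h : ℝ × ℝ → ℝ × ℝ} (hh : ContDiffOn ℝ ∞ h square) {ψ : ℝ → ℝ}
    (hψ : ContDiffOn ℝ ∞ ψ (Icc 0 1)) (hmaps : MapsTo ψ (Icc 0 1) (Icc 0 1)) {i : Fin n}
    (heq : ∀ t ∈ Icc (0 : ℝ) 1, S'.curve i t = h (S.curve i (ψ t))) {t : ℝ}
    (ht : t ∈ Icc (0 : ℝ) 1) (hin : S.curve i (ψ t) ∈ openSquare) :
    velocity S'.curve (i, t) = derivWithin ψ (Icc 0 1) t •
      fderiv ℝ h (S.curve i (ψ t)) (velocity S.curve (i, ψ t)) := by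
  have hud := uniqueDiffOn_Icc (zero_lt_one (α := ℝ)) t ht
  have h1 : HasDerivWithinAt ψ (derivWithin ψ (Icc 0 1) t) (Icc 0 1) t :=
    ((hψ.differentiableOn (by simp)) t ht).hasDerivWithinAt
  have h2 : HasDerivWithinAt (S.curve i) (velocity S.curve (i, ψ t)) (Icc 0 1) (ψ t) :=
    (((S.smooth i).differentiableOn (by simp)) _ (hmaps ht)).hasDerivWithinAt
  have hnh : square ∈ 𝓝 (S.curve i (ψ t)) :=
    mem_of_superset (isOpen_openSquare.mem_nhds hin) openSquare_subset
  have h3 : HasFDerivAt h (fderiv ℝ h (S.curve i (ψ t))) (S.curve i (ψ t)) :=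
    ((hh.contDiffAt hnh).differentiableAt (by simp)).hasFDerivAt
  have h4 := h3.comp_hasDerivWithinAt t (h2.scomp t h1 hmaps)
  rw [map_smul] at h4
  rw [velocity, derivWithin_congr (fun s hs => heq s hs) (heq t ht)]
  exact h4.derivWithin hud

/-- Composing `ν` with the reparametrizations gives a longitude function of `S'`; uniqueness
identifies it with `ν'`, and the reparametrizations fix the final parameter. -/
theorem PlanarIsotopic.longitude_eq (hS : PlanarIsotopic S S') (hν : S.IsLongitude ν)
    (hν' : S'.IsLongitude ν') (i : Fin n) : ν (i, 1) = ν' (i, 1) := by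
  obtain ⟨h, k, ψ, hh, -, -, -, -, -, hdet, hψ, hcurve, hupper⟩ := hS
  have hcont : ∀ i, ContinuousOn (ψ i) (Icc 0 1) := fun i => (hψ i).1.continuousOn
  have hmono : ∀ i, StrictMonoOn (ψ i) (Icc 0 1) := fun i => by
    refine strictMonoOn_of_deriv_pos (convex_Icc _ _) (hcont i) fun t ht => ?_
    rw [interior_Icc] at ht
    rw [← derivWithin_of_mem_nhds (Icc_mem_nhds ht.1 ht.2)]
    exact (hψ i).2.2.2 t (Ioo_subset_Icc_self ht)
  have h0 : (0 : ℝ) ∈ Icc (0 : ℝ) 1 := ⟨le_rfl, zero_le_one⟩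
  have h1 : (1 : ℝ) ∈ Icc (0 : ℝ) 1 := ⟨zero_le_one, le_rfl⟩
  have hmaps : ∀ i, MapsTo (ψ i) (Icc 0 1) (Icc 0 1) := fun i t ht =>
    ⟨(hψ i).2.1 ▸ (hmono i).monotoneOn h0 ht ht.1,
      (hψ i).2.2.1 ▸ (hmono i).monotoneOn ht h1 ht.2⟩
  have hsurj : ∀ i, ∀ s ∈ Icc (0 : ℝ) 1, ∃ t ∈ Icc (0 : ℝ) 1, ψ i t = s := fun i s hs =>
    intermediate_value_Icc zero_le_one (hcont i) (by rwa [(hψ i).2.1, (hψ i).2.2.1])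
  have hstep : ∀ i, ∀ t ∈ Icc (0 : ℝ) 1, ∀ g,
      S'.step (fun p => ν (p.1, ψ p.1 p.2)) (i, t) g = S.step ν (i, ψ i t) g := by
    intro i t ht g
    cases hq : S.upper (i, ψ i t) with
    | none =>
      rw [step_of_upper_eq_none hq]
      refine step_of_upper_eq_none ?_ g
      by_contra hn
      obtain ⟨⟨j, s⟩, hs⟩ := Option.ne_none_iff_exists'.1 hn
      have := (hupper i j t ht s (S'.upper_double _ _ hs).2.1).1 hs
      rw [hq] at this
      cases this
    | some q =>
      obtain ⟨j, s'⟩ := q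
      obtain ⟨-, hs', -, he⟩ := S.upper_double _ _ hq
      obtain ⟨s, hs, rfl⟩ := hsurj j s' hs'
      have hq' := (hupper i j t ht s hs).2 hq
      have hin := S.inside i _ (S.mem_Ioo_of_upper hq).1
      have hsign : S'.crossingSign (i, t) = S.crossingSign (i, ψ i t) := by
        have he : S.curve i (ψ i t) = S.curve j (ψ j s) := he
        rw [crossingSign_of_upper hq, crossingSign_of_upper hq', rot, rot,
          velocity_comp hh (hψ i).1 (hmaps i) (hcurve i) ht hin,
          velocity_comp hh (hψ j).1 (hmaps j) (hcurve j) hs (he ▸ hin), ← he, cross_smul, cross_map,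
          ← mul_assoc]
        -- The cross product of the velocities is multiplied by both speeds of reparametrization and
        -- the Jacobian, all positive, so its sign is unchanged.
        have hpos := mul_pos (mul_pos ((hψ j).2.2.2 s hs) ((hψ i).2.2.2 t ht)) (hdet _ hin)
        simp only [mul_pos_iff_of_pos_left hpos]
      rw [step_of_upper_eq_some hq, step_of_upper_eq_some hq', hsign]
      rfl
  have hlong : S'.IsLongitude fun p => ν (p.1, ψ p.1 p.2) := by
    refine ⟨fun i => ?_, fun i t ht => ?_, fun i t ht => ?_⟩
    · simp only [(hψ i).2.1, hν.start]
    · have ht' := Ico_subset_Icc_self ht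
      have hlt : ψ i t < 1 := (hψ i).2.2.1 ▸ hmono i ht' h1 ht.2
      -- Continuity and strict monotonicity carry the one-sided condition on `ν` at `ψ i t` back to
      -- `t`.
      have htend : Tendsto (ψ i) (𝓝[>] t) (𝓝[>] (ψ i t)) := by
        refine tendsto_nhdsWithin_iff.2 ⟨?_, ?_⟩
        · refine (hcont i t ht').tendsto.mono_left (nhdsWithin_le_of_mem ?_)
          exact mem_of_superset (Ioo_mem_nhdsGT ht.2) fun s hs => ⟨ht.1.trans hs.1.le, hs.2.le⟩
        · filter_upwards [Ioo_mem_nhdsGT ht.2] with s hs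
          exact hmono i ht' ⟨ht.1.trans hs.1.le, hs.2.le⟩ hs.1
      filter_upwards [htend.eventually (hν.right i (ψ i t) ⟨(hmaps i ht').1, hlt⟩)] with s hs
      rw [hs, hstep i t ht']
    · have ht' := Ioc_subset_Icc_self ht
      have hlt : 0 < ψ i t := (hψ i).2.1 ▸ hmono i h0 ht' ht.1
      have htend : Tendsto (ψ i) (𝓝[<] t) (𝓝[<] (ψ i t)) := by
        refine tendsto_nhdsWithin_iff.2 ⟨?_, ?_⟩
        · refine (hcont i t ht').tendsto.mono_left (nhdsWithin_le_of_mem ?_)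
          exact mem_of_superset (Ioo_mem_nhdsLT ht.1) fun s hs => ⟨hs.1.le, hs.2.le.trans ht.2⟩
        · filter_upwards [Ioo_mem_nhdsLT ht.1] with s hs
          exact hmono i ⟨hs.1.le, hs.2.le.trans ht.2⟩ ht' hs.2
      exact htend.eventually (hν.left i (ψ i t) ⟨hlt, (hmaps i ht').2⟩)
  have := hlong.unique hν' (p := (i, 1)) h1
  simpa only [(hψ i).2.2.1] using this

theorem WeldedIsotopic.longitude_eq (h : WeldedIsotopic S S') (i : Fin n) :
    S.longitude (i, 1) = S'.longitude (i, 1) := by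
  induction h with
  | rel S S' h =>
    rcases h with h | h
    · exact h.longitude_eq S.isLongitude_longitude S'.isLongitude_longitude i
    · exact h.longitude_eq S.isLongitude_longitude S'.isLongitude_longitude i
  | refl S => rfl
  | symm S S' _ ih => exact ih.symm
  | trans S S' S'' _ _ ih ih' => exact ih.trans ih'

end StringLinkDiagram

end WeldedMilnor

end

/-! ### Milnor numbers as coefficients of the longitude at the end of the strand -/

theorem mainTheorem7 {n : ℕ} {x : WeldedMilnor.EndPoints n}
    (S S' : WeldedMilnor.StringLinkDiagram x) :
    (∀ (J : List (Fin n)) (i : Fin n) (q : ℕ), J.length < q → S.milnorAt q J i = S.milnor J i) ∧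
    (S.WeldedIsotopic S' → ∀ (J : List (Fin n)) (i : Fin n), S.milnor J i = S'.milnor J i) := by
  refine ⟨fun J i q hq => ?_, fun h J i => ?_⟩
  · rw [WeldedMilnor.StringLinkDiagram.milnor, S.milnorAt_eq hq,
      S.milnorAt_eq (Nat.lt_succ_self _)]
  · rw [WeldedMilnor.StringLinkDiagram.milnor, WeldedMilnor.StringLinkDiagram.milnor,
      S.milnorAt_eq (Nat.lt_succ_self _), S'.milnorAt_eq (Nat.lt_succ_self _), h.longitude_eq]
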